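/- Let $p$ be a prime, let $F$ be a finite extension of $\mathbb{Q}_p$ with ring of integers $\mathcal{O}_F$ (the integral closure of $\mathbb{Z}_p$ in $F$), and let $E/F$ be an elliptic curve that admits a rational $p$-isogeny, that is, an isogeny $\phi : E \to E'$ of degree $p$ defined over $F$ to some elliptic curve $E'/F$. Suppose that $E/F$ has good supersingular reduction: a minimal Weierstrass equation of $E$ over $\mathcal{O}_F$ reduces to an elliptic curve over the residue field of $\mathcal{O}_F$ which has no point of order $p$ over an algebraic closure of the residue field. Then $F/\mathbb{Q}_p$ is ramified, that is, its ramification index satisfies $e(F/\mathbb{Q}_p) > 1$. -/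

import Mathlib

open scoped Polynomial.Bivariate

noncomputable section

/-! ### The ring of integers of a finite extension of `ℚ_[p]` -/

section RingOfIntegers

variable (p : ℕ) [Fact p.Prime] (F : Type*) [Field F]
  [Algebra ℚ_[p] F] [FiniteDimensional ℚ_[p] F]
  [Algebra ℤ_[p] F] [IsScalarTower ℤ_[p] ℚ_[p] F]

/-- The ring of integers of a finite extension `F` of `ℚ_[p]`: the integral closure of `ℤ_[p]`
in `F`. -/
abbrev PadicRingOfIntegers (p : ℕ) [Fact p.Prime] (F : Type*) [Field F] [Algebra ℤ_[p] F] :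
    Subalgebra ℤ_[p] F :=
  integralClosure ℤ_[p] F

instance padicRingOfIntegers_isFractionRing : IsFractionRing (PadicRingOfIntegers p F) F :=
  integralClosure.isFractionRing_of_finite_extension ℚ_[p] F

instance padicRingOfIntegers_isDedekindDomain : IsDedekindDomain (PadicRingOfIntegers p F) :=
  integralClosure.isDedekindDomain ℤ_[p] ℚ_[p] F

theorem mem_padicRingOfIntegers_iff (x : F) :
    x ∈ PadicRingOfIntegers p F ↔ spectralNorm ℚ_[p] F x ≤ 1 := by
  have hx : IsIntegral ℚ_[p] x := Algebra.IsIntegral.isIntegral x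
  rw [spectralNorm, spectralValue_le_one_iff (minpoly.monic hx)]
  constructor
  · intro h n
    have h' : IsIntegral ℤ_[p] x := h
    rw [minpoly.isIntegrallyClosed_eq_field_fractions' ℚ_[p] h', Polynomial.coeff_map]
    exact PadicInt.norm_le_one _
  · intro h
    have hl : minpoly ℚ_[p] x ∈ Polynomial.lifts (algebraMap ℤ_[p] ℚ_[p]) := by
      rw [Polynomial.lifts_iff_coeff_lifts]
      exact fun n => ⟨⟨_, h n⟩, rfl⟩
    obtain ⟨q, hq, -, hm⟩ := Polynomial.lifts_and_degree_eq_and_monic hl (minpoly.monic hx)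
    refine ⟨q, hm, ?_⟩
    rw [← Polynomial.aeval_def, ← Polynomial.aeval_map_algebraMap ℚ_[p], hq, minpoly.aeval]

theorem isUnit_padicRingOfIntegers_iff (x : PadicRingOfIntegers p F) :
    IsUnit x ↔ spectralNorm ℚ_[p] F (x : F) = 1 := by
  have hmul : ∀ a b : F, spectralNorm ℚ_[p] F (a * b) =
      spectralNorm ℚ_[p] F a * spectralNorm ℚ_[p] F b := spectralAlgNorm_mul
  have hone : spectralNorm ℚ_[p] F (1 : F) = 1 := spectralNorm_one
  constructor
  · intro h
    obtain ⟨y, hy⟩ := h.exists_right_inv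
    have hy' : (x : F) * (y : F) = 1 := by exact_mod_cast congrArg Subtype.val hy
    have h1 := hmul x y
    rw [hy', hone] at h1
    have hx := (mem_padicRingOfIntegers_iff p F x).1 x.2
    have hy1 := (mem_padicRingOfIntegers_iff p F y).1 y.2
    have hx0 : 0 ≤ spectralNorm ℚ_[p] F (x : F) := spectralNorm_nonneg _
    nlinarith
  · intro h
    have hx0 : (x : F) ≠ 0 := by
      intro h0
      rw [h0, spectralNorm_zero] at h
      exact zero_ne_one h
    have h1 := hmul x (x : F)⁻¹
    rw [mul_inv_cancel₀ hx0, hone, h, one_mul] at h1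
    refine IsUnit.of_mul_eq_one
      ⟨(x : F)⁻¹, (mem_padicRingOfIntegers_iff p F _).2 h1.symm.le⟩ ?_
    exact Subtype.ext (mul_inv_cancel₀ hx0)

instance padicRingOfIntegers_isLocalRing : IsLocalRing (PadicRingOfIntegers p F) := by
  refine IsLocalRing.of_nonunits_add fun a b ha hb => ?_
  rw [mem_nonunits_iff, isUnit_padicRingOfIntegers_iff] at *
  have ha' := lt_of_le_of_ne ((mem_padicRingOfIntegers_iff p F a).1 a.2) ha
  have hb' := lt_of_le_of_ne ((mem_padicRingOfIntegers_iff p F b).1 b.2) hb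
  exact ((isNonarchimedean_spectralNorm (K := ℚ_[p]) (L := F) a b).trans_lt
    (max_lt ha' hb')).ne

theorem padicRingOfIntegers_not_isField : ¬ IsField (PadicRingOfIntegers p F) := by
  intro h
  have hp : (p : PadicRingOfIntegers p F) ≠ 0 := by
    intro h0
    have h1 : (p : F) = 0 := by
      have h3 := congrArg (PadicRingOfIntegers p F).val h0
      rwa [map_natCast, map_zero] at h3
    have h2 : algebraMap ℚ_[p] F (p : ℚ_[p]) = 0 := by rw [map_natCast, h1]
    rw [map_eq_zero] at h2
    exact (Fact.out : p.Prime).ne_zero (by exact_mod_cast h2)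
  obtain ⟨y, hy⟩ := h.mul_inv_cancel hp
  have hu := (isUnit_padicRingOfIntegers_iff p F _).1 (IsUnit.of_mul_eq_one y hy)
  have he : ((p : PadicRingOfIntegers p F) : F) = algebraMap ℚ_[p] F (p : ℚ_[p]) := by simp
  rw [he, spectralNorm_extends] at hu
  exact (Padic.norm_p_lt_one (p := p)).ne hu

instance padicRingOfIntegers_isDiscreteValuationRing :
    IsDiscreteValuationRing (PadicRingOfIntegers p F) :=
  ((IsDiscreteValuationRing.TFAE (PadicRingOfIntegers p F)
    (padicRingOfIntegers_not_isField p F)).out 0 2).2 (padicRingOfIntegers_isDedekindDomain p F)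

end RingOfIntegers

/-! ### Isogenies of elliptic curves -/

namespace WeierstrassCurve

section Isogeny

variable {F : Type*} [Field F]

/-- The geometric points of `W`, i.e. its points over an algebraic closure of the base field. -/
abbrev GeomPoint (W : WeierstrassCurve F) : Type _ :=
  (W.map (algebraMap F (AlgebraicClosure F))).toAffine.Point

open scoped Classical in
/-- The group structure on the geometric points (chord and tangent law). -/
instance instAddCommGroupGeomPoint (W : WeierstrassCurve F) : AddCommGroup W.GeomPoint :=
  inferInstance

/-- The rational function `f ∈ F(W)` is regular at the geometric point `(x, y)` of `W`, with
value `v` there: `f` can be written as `g / h` with polynomials `g`, `h` over `F` such that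
`h(x, y) ≠ 0` and `g(x, y) / h(x, y) = v`. -/
def HasValueAt (W : WeierstrassCurve F) (f : W.toAffine.FunctionField)
    (x y v : AlgebraicClosure F) : Prop :=
  ∃ g h : F[X][Y], Polynomial.aevalAeval x y h ≠ 0 ∧
    f * algebraMap W.toAffine.CoordinateRing W.toAffine.FunctionField
        (Affine.CoordinateRing.mk W.toAffine h) =
      algebraMap W.toAffine.CoordinateRing W.toAffine.FunctionField
        (Affine.CoordinateRing.mk W.toAffine g) ∧
    Polynomial.aevalAeval x y g = v * Polynomial.aevalAeval x y h

/-- The homomorphism `φ` on geometric points is given by the rational functions `f`, `g` in `F(W)`: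
at every affine point which `φ` does not send to the point at infinity, `f` and `g` are regular and
their values are the coordinates of the image. -/
def IsGivenBy {W W' : WeierstrassCurve F} (φ : W.GeomPoint →+ W'.GeomPoint)
    (f g : W.toAffine.FunctionField) : Prop :=
  ∀ (x y : AlgebraicClosure F)
    (h : (W.map (algebraMap F (AlgebraicClosure F))).toAffine.Nonsingular x y)
    (x' y' : AlgebraicClosure F)
    (h' : (W'.map (algebraMap F (AlgebraicClosure F))).toAffine.Nonsingular x' y'),
    φ (Affine.Point.some x y h) = Affine.Point.some x' y' h' →
      W.HasValueAt f x y x' ∧ W.HasValueAt g x y y'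

/-- The degree `[F(W) : F(f, g)]` of the rational map with coordinates `f`, `g` from `W` to a curve:
the degree of the function field `F(W)` over the subfield generated by `f` and `g`, which is the
image of the pullback of rational functions (and `0` if `F(W)` is not finite over it). -/
def ratMapDegree {W : WeierstrassCurve F} (f g : W.toAffine.FunctionField) : ℕ :=
  Module.finrank (IntermediateField.adjoin F ({f, g} : Set W.toAffine.FunctionField))
    W.toAffine.FunctionField

/-- `φ : W → W'` is an isogeny of degree `n` defined over `F`: a homomorphism with finite kernel
from the group of geometric points of `W` to that of `W'` which is given by rational functions
`f = x' ∘ φ` and `g = y' ∘ φ` in `F(W)`, where `x'`, `y'` are the coordinate functions of `W'`, and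
`n = [F(W) : φ^* F(W')]`, where `φ^* F(W') = F(f, g)`. -/
structure IsIsogenyOfDegree {W W' : WeierstrassCurve F} (φ : W.GeomPoint →+ W'.GeomPoint)
    (n : ℕ) : Prop where
  finite_ker : (φ.ker : Set W.GeomPoint).Finite
  exists_isGivenBy : ∃ f g : W.toAffine.FunctionField, IsGivenBy φ f g ∧ ratMapDegree f g = n

end Isogeny

/-! ### Supersingular reduction -/

/-- An elliptic curve over a field of characteristic `p` is supersingular if it has no geometric
point of order `p`. -/
def IsSupersingular (p : ℕ) {k : Type*} [Field k] (W : WeierstrassCurve k) : Prop :=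
  ∀ P : W.GeomPoint, p • P = 0 → P = 0

/-- `W` has good supersingular reduction: a minimal Weierstrass equation of `W` over the discrete
valuation ring `R` has good reduction and its reduction is supersingular. -/
def HasGoodSupersingularReduction (p : ℕ) (R : Type*) [CommRing R] [IsDomain R]
    [IsDiscreteValuationRing R] {K : Type*} [Field K] [Algebra R K] [IsFractionRing R K]
    (W : WeierstrassCurve K) : Prop :=
  ∃ (C : VariableChange K) (_ : IsMinimal R (C • W)),
    HasGoodReduction R (C • W) ∧ IsSupersingular p ((C • W).reduction R)

end WeierstrassCurve

end

/-! Arguing by contradiction, suppose `p` is not in the square of the maximal ideal, so that `p` is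
a uniformizer. In characteristic zero the kernel of an isogeny of degree `p` has exactly `p`
elements (`card_ker_le`, `ratMapDegree_le_card_ker`), and it is Galois stable because the isogeny is
given by functions over `F` (`galoisMap_mem_ker`). A nonzero point `P` of the kernel is thus killed
by `p`, and its abscissa has at most `p - 1` conjugates.

Supersingular reduction contradicts this (`le_ncard_of_hasGoodSupersingularReduction`). For odd `p`,
the `p`-th division polynomial of an integral model has degree `(p ^ 2 - 1) / 2` and leading
coefficient `p`. Its reduction has no root, since a root would give a point of order `p`, so it is a
nonzero constant. The reversed polynomial is then Eisenstein, and the abscissa has degree `(p ^ 2 -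
1) / 2 ≥ p`. For `p = 2`, a rational abscissa is excluded by a valuation argument on `Ψ₂Sq`
(`Ψ₂Sq_eval_ne_zero_of_isSupersingular`).

The link between torsion and division polynomials goes through `pointEDS`, which is built from the
abscissas of the multiples of a point so that `s (m + 1) * s (m - 1) = (x(P) - x(mP)) * s m ^ 2`. It
agrees with `normEDS` up to the order of the point. Hence torsion points give roots. For the
converse, the elliptic relations are proved at the generic point in characteristic zero and then
specialized to the residue field (`mk_ψ_rel`, `normEDS_rel`). They force the zeros of the sequence
to be multiples of the order (`dvd_of_normEDS_eq_zero`). -/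

section
open Polynomial

/-! ### Abscissas of sums, differences and doubles -/

namespace WeierstrassCurve
namespace Affine.Point
variable {K : Type*} [Field K] {W : Affine K}

/-- The `x`-coordinate of a point, with junk value `0` at infinity. -/
noncomputable def xCoord : W.Point → K
  | 0 => 0
  | some x _ _ => x

@[simp] lemma xCoord_some {x y : K} (h : W.Nonsingular x y) : xCoord (some x y h) = x := rfl

/-- The symmetric form whose roots in `t` are the `x`-coordinates of `A ± B`. -/
def addSubForm (W : Affine K) (t r s : K) : K :=
  t ^ 2 * (r - s) ^ 2 - t * (2 * r * s * (r + s) + W.b₂ * r * s + W.b₄ * (r + s) + W.b₆) +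
    r ^ 2 * s ^ 2 - W.b₄ * r * s - W.b₆ * (r + s) - W.b₈

/-- The relation "some signed sum of three points vanishes" is symmetric in the points. This
symmetry lets one value of the form be factored in two ways, which drives the induction in
`pointEDS_rel`. -/
lemma addSubForm_rotate (t r s : K) : addSubForm W t r s = addSubForm W s t r := by
  unfold addSubForm; ring

lemma xCoord_eq_iff {A B : W.Point} (hA : A ≠ 0) (hB : B ≠ 0) :
    xCoord A = xCoord B ↔ A = B ∨ A = -B := by
  match A, B, hA, hB with
  | some x y h, some x' y' h', _, _ => exact X_eq_iff

variable [DecidableEq K]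

/-- The chords for `A + B` and `A - B` have slopes `a / (x - x')` and `b / (x - x')`. The
Weierstrass equations make the sum and product of the two resulting abscissas rational in `x` and
`x'`. -/
lemma xCoord_add_sub {A B : W.Point} (hA : A ≠ 0) (hB : B ≠ 0) (h : xCoord A ≠ xCoord B) (t : K) :
    (t - xCoord (A + B)) * (t - xCoord (A - B)) * (xCoord A - xCoord B) ^ 2 =
      addSubForm W t (xCoord A) (xCoord B) := by
  match A, B, hA, hB with
  | some x y h₁, some x' y' h₂, _, _ =>
    simp only [xCoord_some] at h ⊢
    rw [sub_eq_add_neg (some x y h₁), neg_some, add_of_X_ne h, add_of_X_ne h]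
    simp only [xCoord_some, addX, slope_of_X_ne h, negY, addSubForm]
    have e₁ := (equation_iff ..).1 h₁.1
    have e₂ := (equation_iff ..).1 h₂.1
    have hd : x - x' ≠ 0 := sub_ne_zero.2 h
    set a := y - y' with ha
    set b := y + y' + W.a₁ * x' + W.a₃ with hb
    set c := W.a₂ + x + x' with hc
    set g := x ^ 2 + x * x' + x' ^ 2 + W.a₂ * (x + x') + W.a₄ with hg
    -- The difference of the two Weierstrass equations is divisible by `x - x'`; this is what
    -- removes the ordinates from the product.
    have hab : a * b = (x - x') * (g - W.a₁ * y) := by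
      rw [ha, hb, hg]; linear_combination e₁ - e₂
    have hsum : a ^ 2 + b ^ 2 + W.a₁ * (a + b) * (x - x') - 2 * c * (x - x') ^ 2 =
        2 * x * x' * (x + x') + W.b₂ * x * x' + W.b₄ * (x + x') + W.b₆ := by
      rw [ha, hb, hc, b₂, b₄, b₆]; linear_combination 2 * e₁ + 2 * e₂
    have hprod : (a ^ 2 + W.a₁ * a * (x - x') - c * (x - x') ^ 2) *
        (b ^ 2 + W.a₁ * b * (x - x') - c * (x - x') ^ 2) =
        (x ^ 2 * x' ^ 2 - W.b₄ * x * x' - W.b₆ * (x + x') - W.b₈) * (x - x') ^ 2 := by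
      have h1 : a * b * (a * b + W.a₁ * (x - x') * (a + b) + W.a₁ ^ 2 * (x - x') ^ 2) =
          (x - x') ^ 2 * (g ^ 2 + g * (W.a₁ ^ 2 * x + W.a₁ * W.a₃) -
            W.a₁ ^ 2 * (x ^ 3 + W.a₂ * x ^ 2 + W.a₄ * x + W.a₆)) := by
        rw [hab, show a + b = 2 * y + W.a₁ * x' + W.a₃ by rw [ha, hb]; ring]
        linear_combination (- W.a₁ ^ 2 * (x - x') ^ 2) * e₁
      have h2 : (a ^ 2 + W.a₁ * a * (x - x') - c * (x - x') ^ 2) *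
        (b ^ 2 + W.a₁ * b * (x - x') - c * (x - x') ^ 2) =
          a * b * (a * b + W.a₁ * (x - x') * (a + b) + W.a₁ ^ 2 * (x - x') ^ 2) -
            c * (x - x') ^ 2 * (a ^ 2 + b ^ 2 + W.a₁ * (a + b) * (x - x') - 2 * c * (x - x') ^ 2)
            - c ^ 2 * (x - x') ^ 4 := by ring
      rw [h2, h1, hsum, hg, hc, b₂, b₄, b₆, b₈]
      ring
    refine mul_right_cancel₀ (pow_ne_zero 2 hd) ?_
    trans (t * (x - x') ^ 2 - (a ^ 2 + W.a₁ * a * (x - x') - c * (x - x') ^ 2)) *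
        (t * (x - x') ^ 2 - (b ^ 2 + W.a₁ * b * (x - x') - c * (x - x') ^ 2))
    · rw [show y - (-y' - W.a₁ * x' - W.a₃) = b by rw [hb]; ring, hc]
      field_simp
      ring
    · linear_combination hprod - t * (x - x') ^ 2 * hsum

/-- The value of `ψ₂` at a point. -/
noncomputable def etaCoord : W.Point → K
  | 0 => 0
  | some x y _ => 2 * y + W.a₁ * x + W.a₃

omit [DecidableEq K] in
lemma etaCoord_sq {A : W.Point} (hA : A ≠ 0) :
    etaCoord A ^ 2 = W.Ψ₂Sq.eval (xCoord A) := by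
  match A, hA with
  | some x y h, _ =>
    have e := (equation_iff ..).1 h.1
    simp only [etaCoord, xCoord_some, Ψ₂Sq, b₂, b₄, b₆]
    simp
    linear_combination 4 * e

lemma etaCoord_eq_zero_iff {A : W.Point} (hA : A ≠ 0) : etaCoord A = 0 ↔ A + A = 0 := by
  match A, hA with
  | some x y h, _ =>
    simp only [etaCoord]
    by_cases hy : y = W.negY x y
    · simp only [add_self_of_Y_eq hy, iff_true]
      rw [negY] at hy
      linear_combination hy
    · rw [add_self_of_Y_ne hy]
      simp only [some_ne_zero, iff_false]
      intro h0
      exact hy (by rw [negY]; linear_combination h0)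

/-- The degenerate case `r = s` of the addition formula: the form becomes linear in `t`, its root
being the abscissa of the double. -/
lemma xCoord_two {A : W.Point} (hA : A ≠ 0) (h : A + A ≠ 0) (t : K) :
    (t - xCoord (A + A)) * W.Ψ₂Sq.eval (xCoord A) =
      -addSubForm W t (xCoord A) (xCoord A) := by
  match A, hA with
  | some x y h₁, _ =>
    by_cases hy : y = W.negY x y
    · exact absurd (add_self_of_Y_eq hy) h
    · have h0 : y - W.negY x y ≠ 0 := sub_ne_zero.2 hy
      rw [← etaCoord_sq (some_ne_zero h₁), add_self_of_Y_ne hy]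
      simp only [xCoord_some, addX, slope_of_Y_ne rfl hy, addSubForm, etaCoord]
      have e := (equation_iff ..).1 h₁.1
      rw [show 2 * y + W.a₁ * x + W.a₃ = y - W.negY x y by rw [negY]; ring]
      set n := 3 * x ^ 2 + 2 * W.a₂ * x + W.a₄ - W.a₁ * y with hn
      trans (t * (y - W.negY x y) ^ 2 - n ^ 2 - W.a₁ * n * (y - W.negY x y) +
        (W.a₂ + 2 * x) * (y - W.negY x y) ^ 2)
      · field_simp
        ring
      · rw [hn, negY, b₂, b₄, b₆, b₈]
        linear_combination (4 * t + 8 * x + W.a₁ ^ 2 + 4 * W.a₂) * e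
      
end Affine.Point
end WeierstrassCurve

/-! ### The elliptic sequence of a point -/

namespace WeierstrassCurve
namespace Affine.Point
variable {K : Type*} [Field K] [DecidableEq K] {W : Affine K}

/-- The elliptic divisibility sequence attached to a point, defined through the `x`-coordinates of
its multiples. -/
noncomputable def pointEDS (P : W.Point) : ℕ → K
  | 0 => 0
  | 1 => 1
  | 2 => etaCoord P
  | n + 3 => (xCoord P - xCoord ((n + 2) • P)) * pointEDS P (n + 2) ^ 2 / pointEDS P (n + 1)

section
variable {P : W.Point} {N : ℕ} (hN : ∀ n, 0 < n → n < N → n • P ≠ 0)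
include hN

lemma xCoord_nsmul_ne {m n : ℕ} (hn : 0 < n) (hnm : n < m) (h : m + n < N) :
    xCoord (m • P) ≠ xCoord (n • P) := by
  rw [Ne, xCoord_eq_iff (hN m (by omega) (by omega)) (hN n hn (by omega))]
  rintro (h' | h')
  · refine hN (m - n) (by omega) (by omega) ?_
    rw [sub_nsmul _ hnm.le, h', add_neg_cancel]
  · refine hN (m + n) (by omega) h ?_
    rw [add_nsmul, h', neg_add_cancel]

lemma xCoord_nsmul_add_sub {m n : ℕ} (hn : 0 < n) (hnm : n < m) (h : m + n < N) (t : K) :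
    (t - xCoord ((m + n) • P)) * (t - xCoord ((m - n) • P)) *
      (xCoord (m • P) - xCoord (n • P)) ^ 2 =
      addSubForm W t (xCoord (m • P)) (xCoord (n • P)) := by
  rw [← xCoord_add_sub (hN m (by omega) (by omega)) (hN n hn (by omega))
    (xCoord_nsmul_ne hN hn hnm h), add_nsmul, sub_nsmul _ hnm.le, sub_eq_add_neg (m • P)]

lemma pointEDS_ne_zero {n : ℕ} (hn : 0 < n) (h : n < N) : pointEDS P n ≠ 0 := by
  have hP : 1 < N → P ≠ 0 := fun h => by simpa using hN 1 one_pos h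
  induction n using Nat.strong_induction_on with
  | _ n ih =>
    match n, hn with
    | 1, _ => exact one_ne_zero
    | 2, _ =>
      rw [pointEDS, Ne, etaCoord_eq_zero_iff (hP (by omega)), ← two_nsmul]
      exact hN 2 two_pos h
    | n + 3, _ =>
      rw [pointEDS]
      refine div_ne_zero (mul_ne_zero (sub_ne_zero.2 (Ne.symm ?_)) (pow_ne_zero 2
        (ih _ (by omega) (by omega) (by omega)))) (ih _ (by omega) (by omega) (by omega))
      simpa using xCoord_nsmul_ne hN one_pos (show 1 < n + 2 by omega) (by omega)

lemma pointEDS_one_rel {m : ℕ} (hm : 1 < m) (h : m < N) :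
    (xCoord P - xCoord (m • P)) * pointEDS P m ^ 2 = pointEDS P (m + 1) * pointEDS P (m - 1) := by
  obtain ⟨n, rfl⟩ : ∃ n, m = n + 2 := ⟨m - 2, by omega⟩
  have h0 : pointEDS P (n + 1) ≠ 0 := pointEDS_ne_zero hN (by omega) (by omega)
  rw [show n + 2 + 1 = n + 3 by rfl, pointEDS, show n + 2 - 1 = n + 1 by omega,
    div_mul_cancel₀ _ h0]

/-- Induction on `n`, with the case `n = 1` built into the recursion. The bound `m + n ≤ N` includes
the order itself, so one side may vanish there, while every term that gets divided by has index
below `N`. -/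
lemma pointEDS_rel {m n : ℕ} (hn : 0 < n) (hnm : n < m) (h : m + n ≤ N) :
    (xCoord (n • P) - xCoord (m • P)) * pointEDS P m ^ 2 * pointEDS P n ^ 2 =
      pointEDS P (m + n) * pointEDS P (m - n) := by
  have h1 : ∀ {k}, 1 < k → k < N → (xCoord P - xCoord (k • P)) =
      pointEDS P (k + 1) * pointEDS P (k - 1) / pointEDS P k ^ 2 := fun hk hkN => by
    rw [eq_div_iff (pow_ne_zero 2 (pointEDS_ne_zero hN (by omega) hkN)),
      pointEDS_one_rel hN hk hkN]
  have hs : ∀ {k}, 0 < k → k < N → pointEDS P k ≠ 0 := pointEDS_ne_zero hN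
  have hP : P ≠ 0 := by simpa using hN 1 one_pos (by omega)
  induction n using Nat.strong_induction_on with
  | _ n ih =>
    match n, hn with
    | 1, _ => simpa [pointEDS] using pointEDS_one_rel hN (by omega) (by omega)
    | 2, _ =>
      -- The form at `x(mP)`, `x(P)`, `x(P)` is computed by doubling `P` and also by adding `±P` to
      -- `mP`.
      have e := xCoord_two hP (by simpa [two_nsmul] using hN 2 (by omega) (by omega))
        (xCoord (m • P))
      have e2 := xCoord_nsmul_add_sub hN one_pos (show 1 < m by omega) (by omega) (xCoord P)
      rw [one_nsmul, addSubForm_rotate, addSubForm_rotate] at e2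
      rw [← e2, ← etaCoord_sq hP, h1 (by omega) (by omega), h1 (by omega) (by omega),
        ← two_nsmul, ← neg_sq (_ - _), neg_sub, h1 (by omega) (by omega)] at e
      rw [show pointEDS P 2 = etaCoord P by rw [pointEDS]]
      have a1 := hs (k := m) (by omega) (by omega)
      have a2 := hs (k := m + 1) (by omega) (by omega)
      have a3 := hs (k := m - 1) (by omega) (by omega)
      rw [show m - 1 + 1 = m by omega, show m - 1 - 1 = m - 2 by omega,
        show m + 1 + 1 = m + 2 by omega, show m + 1 - 1 = m by omega] at e
      field_simp at e
      linear_combination -e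
    | n + 3, _ =>
      have i1 := ih (n + 2) (by omega) (by omega) (by omega) (by omega)
      have i2 := ih (n + 1) (by omega) (by omega) (by omega) (by omega)
      -- The form at the abscissas of `mP`, `(n + 2)P`, `P` is factored through `(n + 2)P ± P` and
      -- through `mP ± (n + 2)P`. All differences other than `x(mP) - x((n + 3)P)` are already known
      -- in terms of the sequence.
      have e1 := xCoord_nsmul_add_sub hN one_pos (show 1 < n + 2 by omega) (by omega)
        (xCoord (m • P))
      have e2 := xCoord_nsmul_add_sub hN (show 0 < n + 2 by omega) (show n + 2 < m by omega)
        (by omega) (xCoord P)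
      rw [one_nsmul, addSubForm_rotate, ← e2, h1 (by omega) (by omega), h1 (by omega) (by omega),
          ← neg_sq (_ - _), neg_sub, h1 (by omega) (by omega)] at e1
      rw [show n + 2 + 1 = n + 3 by omega, show n + 2 - 1 = n + 1 by omega,
        show m + (n + 2) + 1 = m + (n + 3) by omega,
        show m + (n + 2) - 1 = m + (n + 1) by omega,
        show m - (n + 2) - 1 = m - (n + 3) by omega,
        show m - (n + 2) + 1 = m - (n + 1) by omega] at e1
      have a1 := hs (k := m) (by omega) (by omega)
      have a2 := hs (k := n + 2) (by omega) (by omega)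
      have a3 := hs (k := m + (n + 2)) (by omega) (by omega)
      have a4 := hs (k := m - (n + 2)) (by omega) (by omega)
      have a5 := hs (k := m + (n + 1)) (by omega) (by omega)
      have a6 := hs (k := m - (n + 1)) (by omega) (by omega)
      have a7 := hs (k := n + 1) (by omega) (by omega)
      have i1' : xCoord (m • P) - xCoord ((n + 2) • P) =
          -(pointEDS P (m + (n + 2)) * pointEDS P (m - (n + 2)) /
            (pointEDS P m ^ 2 * pointEDS P (n + 2) ^ 2)) := by
        field_simp
        linear_combination -i1
      have i2' : xCoord (m • P) - xCoord ((n + 1) • P) =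
          -(pointEDS P (m + (n + 1)) * pointEDS P (m - (n + 1)) /
            (pointEDS P m ^ 2 * pointEDS P (n + 1) ^ 2)) := by
        field_simp
        linear_combination -i2
      rw [i1', i2'] at e1
      generalize pointEDS P (m + (n + 3)) = s1 at *
      generalize pointEDS P (m - (n + 3)) = s2 at *
      field_simp at e1
      linear_combination e1

/-- The general relation at `(m + 1, m)`, with the abscissas eliminated through their differences
from `x(P)`. This is the recursion defining `normEDS`; the even case uses `(m + 1, m - 1)` in the
same way. -/
lemma pointEDS_odd {m : ℕ} (hm : 2 ≤ m) (h : 2 * m + 1 ≤ N) :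
    pointEDS P (2 * m + 1) = pointEDS P (m + 2) * pointEDS P m ^ 3 -
      pointEDS P (m - 1) * pointEDS P (m + 1) ^ 3 := by
  have e := pointEDS_rel hN (show 0 < m by omega) (show m < m + 1 by omega) (by omega)
  have e1 := pointEDS_one_rel hN (show 1 < m by omega) (by omega)
  have e2 := pointEDS_one_rel hN (show 1 < m + 1 by omega) (by omega)
  rw [show m + 1 + m = 2 * m + 1 by omega, show m + 1 - m = 1 by omega,
    show pointEDS P 1 = 1 by rw [pointEDS]] at e
  rw [show m + 1 + 1 = m + 2 by omega, show m + 1 - 1 = m by omega] at e2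
  linear_combination -e + pointEDS P m ^ 2 * e2 - pointEDS P (m + 1) ^ 2 * e1

lemma pointEDS_even {m : ℕ} (hm : 3 ≤ m) (h : 2 * m ≤ N) :
    pointEDS P (2 * m) * etaCoord P =
      pointEDS P (m - 1) ^ 2 * pointEDS P m * pointEDS P (m + 2) -
      pointEDS P (m - 2) * pointEDS P m * pointEDS P (m + 1) ^ 2 := by
  have e := pointEDS_rel hN (show 0 < m - 1 by omega) (show m - 1 < m + 1 by omega) (by omega)
  have e1 := pointEDS_one_rel hN (show 1 < m - 1 by omega) (by omega)
  have e2 := pointEDS_one_rel hN (show 1 < m + 1 by omega) (by omega)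
  rw [show m + 1 + (m - 1) = 2 * m by omega, show m + 1 - (m - 1) = 2 by omega,
    show pointEDS P 2 = etaCoord P by rw [pointEDS]] at e
  rw [show m + 1 + 1 = m + 2 by omega, show m + 1 - 1 = m by omega] at e2
  rw [show m - 1 + 1 = m by omega, show m - 1 - 1 = m - 2 by omega] at e1
  linear_combination -e + pointEDS P (m - 1) ^ 2 * e2 - pointEDS P (m + 1) ^ 2 * e1

lemma pointEDS_three (h : 3 ≤ N) : pointEDS P 3 = W.Ψ₃.eval (xCoord P) := by
  have hP : P ≠ 0 := by simpa using hN 1 one_pos (by omega)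
  have e := xCoord_two hP (by simpa [two_nsmul] using hN 2 (by omega) (by omega)) (xCoord P)
  rw [← etaCoord_sq hP] at e
  simp only [pointEDS, div_one, two_nsmul, zero_add]
  rw [e]
  simp [addSubForm, Ψ₃]
  ring

lemma pointEDS_four (h : 4 ≤ N) :
    pointEDS P 4 = W.preΨ₄.eval (xCoord P) * etaCoord P := by
  have hP : P ≠ 0 := by simpa using hN 1 one_pos (by omega)
  have e := xCoord_two hP (by simpa [two_nsmul] using hN 2 (by omega) (by omega)) (xCoord P)
  have e3 := xCoord_nsmul_add_sub hN one_pos (show 1 < 2 by omega) (by omega)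
  have h3 := pointEDS_three hN (by omega)
  have hη : etaCoord P ≠ 0 := by
    simpa [pointEDS] using pointEDS_ne_zero hN two_pos (by omega)
  have h4 : pointEDS P 4 = (xCoord P - xCoord (3 • P)) * pointEDS P 3 ^ 2 / etaCoord P := by
    rw [pointEDS, show 1 + 1 = 2 by rfl, show 1 + 2 = 3 by rfl, show pointEDS P 2 = etaCoord P by
      rw [pointEDS]]
  -- Subtracting the values at `t = 0` and `t = 1` isolates the linear coefficient, hence the sum of
  -- the abscissas of `3P` and `P`.
  have e0 := e3 0
  have e1 := e3 1
  rw [h4, h3]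
  have hsq := etaCoord_sq hP
  rw [show 2 - 1 = 1 by rfl, show 2 + 1 = 3 by rfl, one_nsmul] at e0 e1
  rw [div_eq_iff hη, mul_assoc, ← sq, hsq]
  rw [← two_nsmul] at e
  have hsq0 : W.Ψ₂Sq.eval (xCoord P) ≠ 0 := by rw [← hsq]; exact pow_ne_zero 2 hη
  generalize xCoord (3 • P) = z at *
  generalize xCoord (2 • P) = w at *
  generalize xCoord P = x at *
  have hw : w = x + addSubForm W x x x / W.Ψ₂Sq.eval x := by
    field_simp
    linear_combination -e
  have hΨ₃ : W.Ψ₃.eval x = (x - w) * W.Ψ₂Sq.eval x := by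
    rw [e]; simp [addSubForm, Ψ₃]; ring
  have hS : (x - z) * (w - x) ^ 2 = 2 * x * (w - x) ^ 2 -
      (2 * w * x * (w + x) + W.b₂ * w * x + W.b₄ * (w + x) + W.b₆) := by
    simp only [addSubForm] at e0 e1
    linear_combination e1 - e0
  have hb := W.b_relation
  trans (x - z) * (w - x) ^ 2 * W.Ψ₂Sq.eval x ^ 2
  · rw [hΨ₃]; ring
  · rw [hS]
    have hw' : w * W.Ψ₂Sq.eval x = x ^ 4 - W.b₄ * x ^ 2 - 2 * W.b₆ * x - W.b₈ := by
      rw [hw]; field_simp; simp [addSubForm, Ψ₂Sq]; ring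
    generalize hψ : W.Ψ₂Sq.eval x = q at *
    trans 2 * x * (w * q - x * q) ^ 2 - (2 * (w * q) * x * (w * q + x * q) + W.b₂ * (w * q) * x * q
      + W.b₄ * (w * q + x * q) * q + W.b₆ * q ^ 2)
    · ring
    rw [hw', ← hψ]
    simp [Ψ₂Sq, preΨ₄, b₂, b₄, b₆, b₈]
    ring

/-- Up to the order of the point, the sequence of a point is given by the division polynomials. -/
theorem pointEDS_eq_normEDS {n : ℕ} (h : n ≤ N) :
    pointEDS P n =
      normEDS (etaCoord P) (W.Ψ₃.eval (xCoord P)) (W.preΨ₄.eval (xCoord P)) n := by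
  induction n using Nat.strong_induction_on with
  | _ n ih =>
    by_cases h5 : n < 5
    · interval_cases n
      · simp [pointEDS]
      · simp [pointEDS]
      · rw [Nat.cast_ofNat, normEDS_two, pointEDS]
      · rw [Nat.cast_ofNat, normEDS_three, pointEDS_three hN h]
      · rw [Nat.cast_ofNat, normEDS_four, pointEDS_four hN h]
    · obtain ⟨m, rfl | rfl⟩ := n.even_or_odd'
      · have hη : etaCoord P ≠ 0 := by
          simpa [pointEDS] using pointEDS_ne_zero hN two_pos (by omega)
        refine mul_right_cancel₀ hη ?_
        rw [pointEDS_even hN (by omega) h, Nat.cast_mul, Nat.cast_two, normEDS_even,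
          ih _ (by omega) (by omega), ih _ (by omega) (by omega), ih _ (by omega) (by omega),
          ih _ (by omega) (by omega), ih _ (by omega) (by omega)]
        push_cast [show 1 ≤ m by omega, show 2 ≤ m by omega]
        rfl
      · rw [pointEDS_odd hN (by omega) h, Nat.cast_add, Nat.cast_mul, Nat.cast_two, Nat.cast_one,
          normEDS_odd, ih _ (by omega) (by omega), ih _ (by omega) (by omega),
          ih _ (by omega) (by omega), ih _ (by omega) (by omega)]
        push_cast [show 1 ≤ m by omega]
        rfl

/-- Since `(N - 1)P = -P` has the abscissa of `P`, the first factor in the recursion vanishes. -/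
lemma pointEDS_eq_zero (h2 : 2 ≤ N) (h : N • P = 0) : pointEDS P N = 0 := by
  have hP : P ≠ 0 := by simpa using hN 1 one_pos (by omega)
  match N, h2 with
  | 2, _ => rwa [pointEDS, etaCoord_eq_zero_iff hP, ← two_nsmul]
  | n + 3, _ =>
    rw [pointEDS, (xCoord_eq_iff hP (hN (n + 2) (by omega) (by omega))).2 (.inr ?_)]
    · simp
    · rw [eq_neg_iff_add_eq_zero, ← succ_nsmul', h]

end
end Affine.Point
end WeierstrassCurve

/-! ### Torsion points are roots of division polynomials -/

namespace WeierstrassCurve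

lemma preΨ'_eval_eq_normEDS {K : Type*} [Field K] (W : WeierstrassCurve K) {x η : K}
    (h : η ^ 2 = W.Ψ₂Sq.eval x) {n : ℕ} (hn : Odd n) :
    (W.preΨ' n).eval x = normEDS η (W.Ψ₃.eval x) (W.preΨ₄.eval x) n := by
  rw [normEDS_ofNat, if_neg (Nat.not_even_iff_odd.2 hn), mul_one, preΨ', ← coe_evalRingHom,
    map_preNormEDS', map_pow, coe_evalRingHom, ← h, ← pow_mul]

namespace Affine.Point

/-- The `x`-coordinate of a point of odd prime order is a root of the division polynomial. -/
theorem preΨ'_eval_xCoord_eq_zero {K : Type*} [Field K] [DecidableEq K] {W : Affine K}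
    {P : W.Point} {p : ℕ} (hp : p.Prime) (hp2 : p ≠ 2) (hP : P ≠ 0) (h : p • P = 0) :
    (W.preΨ' p).eval (xCoord P) = 0 := by
  have hN : ∀ n, 0 < n → n < p → n • P ≠ 0 := fun n hn hnp h0 => by
    have : Fact p.Prime := ⟨hp⟩
    have := addOrderOf_dvd_of_nsmul_eq_zero h0
    rw [addOrderOf_eq_prime h hP] at this
    exact Nat.not_dvd_of_pos_of_lt hn hnp this
  rw [preΨ'_eval_eq_normEDS W (etaCoord_sq hP) (hp.odd_of_ne_two hp2),
    ← pointEDS_eq_normEDS hN le_rfl, pointEDS_eq_zero hN hp.two_le h]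

end Affine.Point

/-- Every abscissa over an algebraically closed field is that of a point. -/
lemma Affine.exists_equation {k : Type*} [Field k] [IsAlgClosed k] (W : Affine k) (x : k) :
    ∃ y, W.Equation x y := by
  obtain ⟨y, hy⟩ := IsAlgClosed.exists_root
    (X ^ 2 + C (W.a₁ * x + W.a₃) * X - C (x ^ 3 + W.a₂ * x ^ 2 + W.a₄ * x + W.a₆)) (by
        rw [add_sub_assoc, degree_add_eq_left_of_degree_lt] <;> rw [degree_X_pow]
        · decide
        · exact (degree_sub_le _ _).trans_lt (max_lt ((degree_C_mul_X_le _).trans_lt (by decide))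
            (degree_C_le.trans_lt (by decide))))
  refine ⟨y, (Affine.equation_iff ..).2 ?_⟩
  simp only [IsRoot, eval_sub, eval_add, eval_mul, eval_pow, eval_X, eval_C] at hy
  linear_combination hy

/-! ### The generic point and the elliptic relations -/

section Generic

variable {R : Type*} [CommRing R] (W : WeierstrassCurve R)

lemma map_Ψ₃_eval {S : Type*} [CommRing S] (f : R →+* S) (x : S) :
    (W.map f).Ψ₃.eval x = W.Ψ₃.eval₂ f x := by rw [map_Ψ₃, eval_map]

lemma map_preΨ₄_eval {S : Type*} [CommRing S] (f : R →+* S) (x : S) :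
    (W.map f).preΨ₄.eval x = W.preΨ₄.eval₂ f x := by rw [map_preΨ₄, eval_map]

/-- Evaluation of the coordinate ring at a point with coordinates in another ring. -/
noncomputable def coordEval {S : Type*} [CommRing S] (f : R →+* S) {x y : S}
    (h : (W.map f).toAffine.Equation x y) : W.toAffine.CoordinateRing →+* S :=
  AdjoinRoot.lift (eval₂RingHom f x) y (by
    rw [Affine.Equation, Affine.map_polynomial] at h
    rw [eval₂_eval₂RingHom_apply]
    exact h)

lemma coordEval_C {S : Type*} [CommRing S] (f : R →+* S) {x y : S}
    (h : (W.map f).toAffine.Equation x y) (q : R[X]) :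
    W.coordEval f h (Affine.CoordinateRing.mk W.toAffine (C q)) = q.eval₂ f x := by
  rw [coordEval, Affine.CoordinateRing.mk]; simp

lemma coordEval_Y {S : Type*} [CommRing S] (f : R →+* S) {x y : S}
    (h : (W.map f).toAffine.Equation x y) :
    W.coordEval f h (Affine.CoordinateRing.mk W.toAffine Y) = y := by
  rw [coordEval, Affine.CoordinateRing.mk]; simp

lemma coordEval_ψ {S : Type*} [CommRing S] (f : R →+* S) {x y : S}
    (h : (W.map f).toAffine.Equation x y) (n : ℤ) :
    W.coordEval f h (Affine.CoordinateRing.mk W.toAffine (W.ψ n)) =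
      normEDS (2 * y + (W.map f).a₁ * x + (W.map f).a₃) ((W.map f).Ψ₃.eval x)
        ((W.map f).preΨ₄.eval x) n := by
  rw [WeierstrassCurve.ψ, map_normEDS, map_normEDS, coordEval_C, coordEval_C, map_Ψ₃_eval,
    map_preΨ₄_eval, ψ₂, Affine.polynomialY]
  simp only [map_add, map_mul, coordEval_C, coordEval_Y]
  congr 1
  simp only [eval₂_C, eval₂_X, eval₂_ofNat, add_assoc, map_a₁, map_a₃, map_ofNat]

/-- Homomorphisms out of the coordinate ring are points of the curve; the embedding into the
function field is the generic point. -/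
lemma equation_of_coordHom {S : Type*} [CommRing S] (g : W.toAffine.CoordinateRing →+* S) :
    (W.map (g.comp (algebraMap R _))).toAffine.Equation
      (g (Affine.CoordinateRing.mk W.toAffine (C X))) (g (Affine.CoordinateRing.mk W.toAffine Y)) := by
  rw [Affine.Equation, Affine.map_polynomial, ← eval₂_eval₂RingHom_apply]
  have : eval₂RingHom (eval₂RingHom (g.comp (algebraMap R _))
      (g (Affine.CoordinateRing.mk W.toAffine (C X)))) (g (Affine.CoordinateRing.mk W.toAffine Y)) =
      g.comp (Affine.CoordinateRing.mk W.toAffine) := by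
    ext a
    · simp; rfl
    · simp
    · simp
  rw [← coe_eval₂RingHom, this, RingHom.comp_apply, Affine.CoordinateRing.mk, AdjoinRoot.mk_self,
    map_zero]

lemma coordHom_eq_coordEval {S : Type*} [CommRing S] (g : W.toAffine.CoordinateRing →+* S) :
    W.coordEval _ (W.equation_of_coordHom g) = g := by
  refine AdjoinRoot.ringHom_ext ?_ ?_
  · ext a
    · simp [coordEval]; rfl
    · simp [coordEval]
  · simp [coordEval]

variable [IsDomain R]

lemma mk_ψ_ne_zero [CharZero R] {n : ℤ} (hn : n ≠ 0) :
    Affine.CoordinateRing.mk W.toAffine (W.ψ n) ≠ 0 := by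
  rw [Affine.CoordinateRing.mk_ψ]
  intro h
  have h2 := Affine.CoordinateRing.mk_Ψ_sq W n
  rw [h, zero_pow two_ne_zero] at h2
  refine W.ΨSq_ne_zero (n := n) (by exact_mod_cast hn) ?_
  exact FaithfulSMul.algebraMap_injective R[X] W.toAffine.CoordinateRing
    (by rw [_root_.map_zero]; exact h2.symm)

/-- Division polynomials in characteristic zero satisfy the relations of an elliptic sequence. -/
theorem mk_ψ_rel [CharZero R] (hΔ : W.Δ ≠ 0) {m n : ℕ} (hn : 0 < n) (hnm : n < m) :
    Affine.CoordinateRing.mk W.toAffine (W.ψ (m + n : ℕ) * W.ψ (m - n : ℕ)) =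
      Affine.CoordinateRing.mk W.toAffine (W.ψ (m + 1 : ℕ) * W.ψ (m - 1 : ℕ) * W.ψ n ^ 2 -
        W.ψ (n + 1 : ℕ) * W.ψ (n - 1 : ℕ) * W.ψ m ^ 2) := by
  classical
  let g := algebraMap W.toAffine.CoordinateRing W.toAffine.FunctionField
  have hg : Function.Injective g := IsFractionRing.injective _ _
  have heq := W.equation_of_coordHom g
  set W' := W.map (g.comp (algebraMap R _)) with hW'
  have hf : Function.Injective (g.comp (algebraMap R W.toAffine.CoordinateRing)) :=
    hg.comp (FaithfulSMul.algebraMap_injective _ _)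
  have hΔ' : W'.Δ ≠ 0 := by
    rw [hW', map_Δ]
    exact (map_ne_zero_iff _ hf).2 hΔ
  let P : W'.toAffine.Point := .some _ _ ((Affine.equation_iff_nonsingular_of_Δ_ne_zero hΔ').1 heq)
  have hψ (n : ℤ) : g (Affine.CoordinateRing.mk W.toAffine (W.ψ n)) =
      normEDS P.etaCoord (W'.Ψ₃.eval P.xCoord) (W'.preΨ₄.eval P.xCoord) n := by
    have h := W.coordEval_ψ _ heq n
    rwa [coordHom_eq_coordEval] at h
  -- The generic point has infinite order: at a finite order `N` the sequence would vanish, making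
  -- `ψ N` zero in the coordinate ring.
  have hN : ∀ n, 0 < n → n • P ≠ 0 := by
    by_contra! h
    classical
    have h1 := (Nat.find_spec h).1
    have h2 := (Nat.find_spec h).2
    have h3 : ∀ n, 0 < n → n < Nat.find h → n • P ≠ 0 := fun n hn hnf h0 =>
      Nat.find_min h hnf ⟨hn, h0⟩
    have h4 : Nat.find h ≠ 1 := fun h1 => by
      rw [h1, one_nsmul] at h2
      exact Affine.Point.some_ne_zero _ h2
    have h5 := Affine.Point.pointEDS_eq_zero h3 (by omega) h2
    rw [Affine.Point.pointEDS_eq_normEDS h3 le_rfl, ← hψ, map_eq_zero_iff _ hg] at h5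
    exact W.mk_ψ_ne_zero (by omega) h5
  have hN' {N : ℕ} : ∀ n, 0 < n → n < N → n • P ≠ 0 := fun n hn _ => hN n hn
  have key (n : ℕ) : g (Affine.CoordinateRing.mk W.toAffine (W.ψ n)) = P.pointEDS n := by
    rw [hψ, Affine.Point.pointEDS_eq_normEDS hN' le_rfl]
  apply hg
  simp only [map_mul, map_sub, map_pow, key]
  have r := Affine.Point.pointEDS_rel (hN' (N := m + n + 2)) hn hnm (by omega)
  have r1 := Affine.Point.pointEDS_one_rel (hN' (N := m + n + 2)) (show 1 < m by omega) (by omega)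
  obtain rfl | hn1 : n = 1 ∨ 1 < n := by omega
  · simp [Affine.Point.pointEDS]
  · have r2 := Affine.Point.pointEDS_one_rel (hN' (N := m + n + 2)) hn1 (by omega)
    linear_combination -r + P.pointEDS n ^ 2 * r1 - P.pointEDS m ^ 2 * r2

end Generic

/-! ### Roots of division polynomials give torsion points -/

section Specialization

variable {R : Type*} [CommRing R] [IsDomain R] [CharZero R] (W : WeierstrassCurve R)
  {k : Type*} [Field k] [DecidableEq k] {f : R →+* k}

omit [DecidableEq k] in
-- The generic relation is an identity in the coordinate ring over `R`, so it can be evaluated at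
-- any affine point over `k`. Unlike `pointEDS_rel`, it carries no restriction from the order of the
-- point.
lemma normEDS_rel (hΔ : (W.map f).Δ ≠ 0) {P : (W.map f).toAffine.Point} (hP : P ≠ 0) {m n : ℕ}
    (hn : 0 < n) (hnm : n < m) :
    letI s (n : ℕ) := normEDS P.etaCoord ((W.map f).Ψ₃.eval P.xCoord)
      ((W.map f).preΨ₄.eval P.xCoord) n
    s (m + n) * s (m - n) = s (m + 1) * s (m - 1) * s n ^ 2 - s (n + 1) * s (n - 1) * s m ^ 2 := by
  match P, hP with
  | .some x y h, _ =>
    have := congrArg (W.coordEval f h.1) (W.mk_ψ_rel (by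
      rintro h; rw [map_Δ, h, map_zero] at hΔ; exact hΔ rfl) hn hnm)
    simp only [map_mul, map_sub, map_pow, coordEval_ψ] at this
    exact this

omit [DecidableEq k] in
-- No point is both 2-torsion and 3-torsion. The vector `(x ^ 2, 2 * x, 1)` encodes the pair of
-- abscissas `x, x`; a common zero would send it to zero under `addSubMap`.
lemma Ψ₃_eval_ne_zero (W : WeierstrassCurve k) (hΔ : W.Δ ≠ 0) {x : k} (h : W.Ψ₂Sq.eval x = 0) :
    W.Ψ₃.eval x ≠ 0 := by
  intro h3
  have : W.IsElliptic := ⟨hΔ.isUnit⟩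
  have h1 := W.addSubMap_ne_zero (x := ![x ^ 2, 2 * x, 1]) (by
    intro h; simpa using congrFun h 2)
  apply h1
  simp [Ψ₂Sq, Ψ₃] at h h3
  ext i
  fin_cases i
  · simp [addSubMap]
    linear_combination x * h - h3
  · simp [addSubMap]
    linear_combination h
  · simp [addSubMap]
    ring

omit [DecidableEq k] in
lemma preΨ₄_add_Ψ₂Sq_sq (W : WeierstrassCurve k) (x : k) :
    W.preΨ₄.eval x + W.Ψ₂Sq.eval x ^ 2 =
      W.Ψ₃.eval x * (6 * x ^ 2 + W.b₂ * x + W.b₄) := by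
  simp [preΨ₄, Ψ₂Sq, Ψ₃, b₂, b₄, b₆, b₈]
  ring

/-- If the curve lifts to characteristic zero, the zeros of the sequence of a point of finite order
are the multiples of the order. -/
theorem dvd_of_normEDS_eq_zero (hΔ : (W.map f).Δ ≠ 0) {P : (W.map f).toAffine.Point} {N : ℕ}
    (h2 : 2 ≤ N) (hN : ∀ n, 0 < n → n < N → n • P ≠ 0) (h0 : N • P = 0) {n : ℕ}
    (h : normEDS P.etaCoord ((W.map f).Ψ₃.eval P.xCoord) ((W.map f).preΨ₄.eval P.xCoord) n = 0) :
    N ∣ n := by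
  have hP : P ≠ 0 := by simpa using hN 1 one_pos (by omega)
  have rel := fun {m n : ℕ} => W.normEDS_rel (m := m) (n := n) hΔ hP
  have hsq : P.etaCoord ^ 2 = (W.map f).Ψ₂Sq.eval P.xCoord := Affine.Point.etaCoord_sq hP
  set s : ℕ → k := fun n => normEDS P.etaCoord ((W.map f).Ψ₃.eval P.xCoord)
      ((W.map f).preΨ₄.eval P.xCoord) n with hsdef
  have hs {n : ℕ} (hn : n ≤ N) : P.pointEDS n = s n := Affine.Point.pointEDS_eq_normEDS hN hn
  have h3 : s 3 = (W.map f).Ψ₃.eval P.xCoord := normEDS_three _ _ _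
  have h4 : s 4 = (W.map f).preΨ₄.eval P.xCoord * P.etaCoord := normEDS_four _ _ _
  have hne {n : ℕ} (hn : 0 < n) (hnN : n < N) : s n ≠ 0 := by
    rw [← hs hnN.le]; exact Affine.Point.pointEDS_ne_zero hN hn hnN
  have hsN : s N = 0 := by rw [← hs le_rfl, Affine.Point.pointEDS_eq_zero hN h2 h0]
  -- No two consecutive terms vanish. For `N ≥ 4` the relation at `(N - 1, 2)` would force one of `s
  -- 1`, `s 3`, `s (N - 1)` to be zero; `N = 2` and `N = 3` need the explicit polynomials.
  have hsN1 : s (N + 1) ≠ 0 := by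
    intro hN1
    obtain rfl | rfl | h4' : N = 2 ∨ N = 3 ∨ 4 ≤ N := by omega
    · have : P.etaCoord = 0 := by rw [← hsN, ← hs le_rfl, Affine.Point.pointEDS]
      rw [this, zero_pow two_ne_zero] at hsq
      exact Ψ₃_eval_ne_zero _ hΔ hsq.symm (h3.symm.trans hN1)
    · have hη : P.etaCoord ≠ 0 := by
        simpa [Affine.Point.pointEDS] using Affine.Point.pointEDS_ne_zero hN two_pos (by omega)
      have e := preΨ₄_add_Ψ₂Sq_sq (W.map f) P.xCoord
      rw [← h3, hsN, zero_mul, ← hsq] at e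
      have e4 := h4.symm.trans hN1
      rw [mul_eq_zero, or_iff_left hη] at e4
      rw [e4, zero_add] at e
      exact hη (by simpa using e)
    · have := rel two_pos (show 2 < N - 1 by omega)
      change s _ * s _ = s _ * s _ * s _ ^ 2 - s _ * s _ * s _ ^ 2 at this
      rw [show N - 1 + 2 = N + 1 by omega, show N - 1 + 1 = N by omega, hN1, hsN] at this
      have h1 : s (2 - 1) ≠ 0 := hne (by omega) (by omega)
      have h3 : s (2 + 1) ≠ 0 := hne (by omega) (by omega)
      have h5 : s (N - 1) ≠ 0 := hne (by omega) (by omega)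
      simp [h1, h3, h5] at this
  change s n = 0 at h
  induction n using Nat.strong_induction_on with
  | _ n ih =>
    rcases Nat.eq_zero_or_pos n with rfl | hn
    · exact dvd_zero _
    rcases lt_or_ge n N with hnN | hnN
    · exact absurd h (hne hn hnN)
    obtain ⟨m, rfl⟩ := Nat.exists_eq_add_of_le hnN
    refine (Nat.dvd_add_right dvd_rfl).2 ?_
    rcases Nat.eq_zero_or_pos m with rfl | hm
    · exact dvd_zero _
    refine ih m (by omega) ?_
    have hsN' : s (N - 1) ≠ 0 := hne (by omega) (by omega)
    -- In the relation for the pair `m`, `N`, the terms containing `s (N + m)` or `s N` drop out.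
    -- What remains is `s (N + 1) * s (N - 1) * s m ^ 2 = 0`.
    rcases lt_trichotomy m N with hmN | rfl | hmN
    · have := rel hm hmN
      change s _ * s _ = s _ * s _ * s _ ^ 2 - s _ * s _ * s _ ^ 2 at this
      simpa [h, hsN, hsN1, hsN'] using this
    · exact hsN
    · have := rel (show 0 < N by omega) hmN
      change s _ * s _ = s _ * s _ * s _ ^ 2 - s _ * s _ * s _ ^ 2 at this
      rw [add_comm m] at this
      simpa [h, hsN, hsN1, hsN'] using this

/-- Over an algebraically closed field, a root of the `p`-th division polynomial yields a point of
order `p`, provided that the curve lifts to characteristic zero. -/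
theorem exists_nsmul_eq_zero_of_root [IsAlgClosed k] (hΔ : (W.map f).Δ ≠ 0) {p : ℕ} (hp : p.Prime)
    (hp2 : p ≠ 2) {x : k} (hx : ((W.map f).preΨ' p).eval x = 0) :
    ∃ P : (W.map f).toAffine.Point, P ≠ 0 ∧ p • P = 0 := by
  obtain ⟨y, heq⟩ := (W.map f).toAffine.exists_equation x
  let P : (W.map f).toAffine.Point :=
    .some x y ((Affine.equation_iff_nonsingular_of_Δ_ne_zero hΔ).1 heq)
  have hP : P ≠ 0 := Affine.Point.some_ne_zero _
  refine ⟨P, hP, ?_⟩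
  have h0 : normEDS P.etaCoord ((W.map f).Ψ₃.eval P.xCoord) ((W.map f).preΨ₄.eval P.xCoord) p = 0 := by
    rw [← preΨ'_eval_eq_normEDS _ (Affine.Point.etaCoord_sq hP) (hp.odd_of_ne_two hp2)]
    exact hx
  have hex : ∃ n, 0 < n ∧ n • P = 0 := by
    by_contra! h
    have hN : ∀ n, 0 < n → n < p + 1 → n • P ≠ 0 := fun n hn _ => h n hn
    refine Affine.Point.pointEDS_ne_zero hN hp.pos (Nat.lt_succ_self p) ?_
    rw [Affine.Point.pointEDS_eq_normEDS hN (Nat.le_succ p)]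
    exact h0
  classical
  have h1 := Nat.find_spec hex
  have h4 : Nat.find hex ≠ 1 := fun h2 => by
    rw [h2, one_nsmul] at h1
    exact hP h1.2
  have hdvd := W.dvd_of_normEDS_eq_zero hΔ (by omega)
    (fun n hn hnf h0 => Nat.find_min hex hnf ⟨hn, h0⟩) h1.2 h0
  rw [((Nat.dvd_prime hp).1 hdvd).resolve_left h4] at h1
  exact h1.2

end Specialization
end WeierstrassCurve

/-! ### Change of Weierstrass equation -/

/-- The sequence is homogeneous of weight `n ^ 2 - 1` for odd `n` and `n ^ 2 - 4` for even `n`. The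
subtracted exponent is moved to the left to avoid truncated subtraction. -/
lemma preNormEDS'_scale {K : Type*} [Field K] {u : K} (hu : u ≠ 0) (b c d : K) (n : ℕ) :
    preNormEDS' (u ^ 12 * b) (u ^ 8 * c) (u ^ 12 * d) n * u ^ (if Even n then 4 else 1) =
      u ^ (n ^ 2) * preNormEDS' b c d n := by
  induction n using Nat.strong_induction_on with
  | _ n ih =>
    have ih' (k : ℕ) (hk : k < n) : preNormEDS' (u ^ 12 * b) (u ^ 8 * c) (u ^ 12 * d) k =
        u ^ (k ^ 2) * preNormEDS' b c d k / u ^ (if Even k then 4 else 1) := by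
      rw [eq_div_iff (pow_ne_zero _ hu), ih k hk]
    by_cases h5 : n < 5
    · interval_cases n
      · simp
      · simp
      · simp [preNormEDS'_two]
      · simp [preNormEDS'_three, show ¬ Even 3 by decide]; ring
      · simp [preNormEDS'_four, show Even 4 by decide]; ring
    · obtain ⟨m, rfl | rfl⟩ := n.even_or_odd'
      · obtain ⟨m, rfl⟩ : ∃ k, m = k + 3 := ⟨m - 3, by omega⟩
        have i1 := ih' (m + 2) (by omega)
        have i2 := ih' (m + 3) (by omega)
        have i3 := ih' (m + 5) (by omega)
        have i4 := ih' (m + 1) (by omega)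
        have i5 := ih' (m + 4) (by omega)
        rw [preNormEDS'_even, preNormEDS'_even, if_pos (even_two_mul _), i1, i2, i3, i4, i5]
        by_cases hm : Even m <;>
        · simp only [hm, Nat.even_add, even_two, show ¬ Even 1 by decide, show ¬ Even 3 by decide,
            show ¬ Even 5 by decide, show Even 4 by decide, iff_true, iff_false, not_true,
            if_true, if_false]
          field_simp
          ring
      · obtain ⟨m, rfl⟩ : ∃ k, m = k + 2 := ⟨m - 2, by omega⟩
        have i1 := ih' (m + 4) (by omega)
        have i2 := ih' (m + 2) (by omega)
        have i3 := ih' (m + 1) (by omega)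
        have i4 := ih' (m + 3) (by omega)
        rw [preNormEDS'_odd, preNormEDS'_odd, i1, i2, i3, i4,
          if_neg (Nat.not_even_two_mul_add_one _)]
        by_cases hm : Even m <;>
        · simp only [hm, Nat.even_add, even_two, show ¬ Even 1 by decide, show ¬ Even 3 by decide,
            show Even 4 by decide, iff_true, iff_false, not_true,
            if_true, if_false]
          field_simp
          ring

namespace WeierstrassCurve

section VariableChange
variable {K : Type*} [Field K] (W : WeierstrassCurve K) (C : VariableChange K) (x : K)

lemma Ψ₂Sq_variableChange :
    W.Ψ₂Sq.eval (C.u ^ 2 * x + C.r) = C.u ^ 6 * (C • W).Ψ₂Sq.eval x := by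
  have hu : (C.u : K) ≠ 0 := C.u.ne_zero
  simp only [Ψ₂Sq, variableChange_b₂, variableChange_b₄, variableChange_b₆, eval_add, eval_mul,
    eval_pow, eval_X, eval_C, Units.val_inv_eq_inv_val]
  field_simp
  ring

lemma Ψ₃_variableChange :
    W.Ψ₃.eval (C.u ^ 2 * x + C.r) = C.u ^ 8 * (C • W).Ψ₃.eval x := by
  have hu : (C.u : K) ≠ 0 := C.u.ne_zero
  simp only [Ψ₃, variableChange_b₂, variableChange_b₄, variableChange_b₆, variableChange_b₈,
    eval_add, eval_mul, eval_pow, eval_X, eval_C, Units.val_inv_eq_inv_val, eval_ofNat]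
  field_simp
  ring

lemma preΨ₄_variableChange :
    W.preΨ₄.eval (C.u ^ 2 * x + C.r) = C.u ^ 12 * (C • W).preΨ₄.eval x := by
  have hu : (C.u : K) ≠ 0 := C.u.ne_zero
  simp only [preΨ₄, variableChange_b₂, variableChange_b₄, variableChange_b₆, variableChange_b₈,
    eval_add, eval_mul, eval_pow, eval_X, eval_C, Units.val_inv_eq_inv_val, eval_ofNat]
  field_simp
  simp only [b₂, b₄, b₆, b₈]
  ring

lemma preΨ'_variableChange_eq_zero {n : ℕ} (h : (W.preΨ' n).eval (C.u ^ 2 * x + C.r) = 0) :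
    ((C • W).preΨ' n).eval x = 0 := by
  have hu : (C.u : K) ≠ 0 := C.u.ne_zero
  rw [preΨ', ← coe_evalRingHom, map_preNormEDS', map_pow, coe_evalRingHom, Ψ₂Sq_variableChange,
    Ψ₃_variableChange, preΨ₄_variableChange, mul_pow, ← pow_mul] at h
  have e := preNormEDS'_scale hu ((C • W).Ψ₂Sq.eval x ^ 2) ((C • W).Ψ₃.eval x)
    ((C • W).preΨ₄.eval x) n
  rw [h, zero_mul, zero_eq_mul] at e
  rw [preΨ', ← coe_evalRingHom, map_preNormEDS', map_pow, coe_evalRingHom]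
  exact e.resolve_left (pow_ne_zero _ hu)

end VariableChange

/-! ### Division polynomials under supersingular reduction -/

section Supersingular
open IsLocalRing

variable {R : Type*} [CommRing R] [IsDomain R] [IsDiscreteValuationRing R] [CharZero R]
  {W : WeierstrassCurve R} {p : ℕ}

omit [CharZero R] in
lemma Δ_map_residue_ne_zero (hΔ : IsUnit W.Δ) :
    (W.map ((algebraMap (ResidueField R) (AlgebraicClosure (ResidueField R))).comp (residue R))).Δ
      ≠ 0 := by
  rw [map_Δ]
  exact (hΔ.map _).ne_zero

/-- For supersingular reduction the division polynomial of odd level `p` reduces to a nonzero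
constant. -/
theorem preΨ'_coeff_of_isSupersingular (hΔ : IsUnit W.Δ) (hp : p.Prime) (hp2 : p ≠ 2)
    (h : IsSupersingular p (W.map (residue R))) :
    (W.preΨ' p).coeff 0 ∉ maximalIdeal R ∧ ∀ i, 0 < i → (W.preΨ' p).coeff i ∈ maximalIdeal R := by
  classical
  have hdeg : ((W.map ((algebraMap (ResidueField R) (AlgebraicClosure (ResidueField R))).comp
      (residue R))).preΨ' p).degree = 0 := by
    -- The assumption `degree ≠ 0` also covers the zero polynomial, so its negation gives a nonzero
    -- constant.
    by_contra hd
    obtain ⟨x, hx⟩ := IsAlgClosed.exists_root _ hd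
    obtain ⟨P, hP, hP0⟩ := W.exists_nsmul_eq_zero_of_root (Δ_map_residue_ne_zero hΔ) hp hp2 hx
    exact hP (h P hP0)
  rw [map_preΨ', ← Polynomial.map_map, degree_map] at hdeg
  have h0 (i : ℕ) : ((W.preΨ' p).map (residue R)).coeff i = residue R ((W.preΨ' p).coeff i) :=
    coeff_map _ _
  refine ⟨?_, fun i hi => ?_⟩
  · rw [← residue_eq_zero_iff, ← h0]
    exact coeff_ne_zero_of_eq_degree hdeg
  · rw [← residue_eq_zero_iff, ← h0]
    exact coeff_eq_zero_of_degree_lt (by rw [hdeg]; exact_mod_cast hi)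

omit [CharZero R] in
/-- A supersingular reduction in residue characteristic two has `a₁ = 0`. -/
lemma a₁_mem_of_isSupersingular (hΔ : IsUnit W.Δ) (h2 : (2 : R) ∈ maximalIdeal R)
    (h : IsSupersingular 2 (W.map (residue R))) : W.a₁ ∈ maximalIdeal R := by
  classical
  by_contra ha
  rw [← residue_eq_zero_iff] at ha h2
  set f := (algebraMap (ResidueField R) (AlgebraicClosure (ResidueField R))).comp (residue R)
  have h2' : (2 : AlgebraicClosure (ResidueField R)) = 0 := by
    have := congrArg (algebraMap (ResidueField R) (AlgebraicClosure (ResidueField R))) h2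
    simpa only [map_ofNat, map_zero] using this
  have ha' : (W.map f).a₁ ≠ 0 := by
    rw [map_a₁]
    exact (map_ne_zero_iff _ (algebraMap _ (AlgebraicClosure (ResidueField R))).injective).2 ha
  -- In characteristic two `2y + a₁x + a₃` does not involve `y`, and this abscissa is its zero; the
  -- point above it is 2-torsion.
  obtain ⟨y, hy⟩ := (W.map f).toAffine.exists_equation (-(W.map f).a₃ / (W.map f).a₁)
  have hns := (Affine.equation_iff_nonsingular_of_Δ_ne_zero (Δ_map_residue_ne_zero hΔ)).1 hy
  refine Affine.Point.some_ne_zero hns (h (.some _ _ hns) ?_)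
  rw [two_nsmul]
  refine Affine.Point.add_self_of_Y_eq ?_
  rw [Affine.negY]
  change y = -y - (W.map f).a₁ * (-(W.map f).a₃ / (W.map f).a₁) - (W.map f).a₃
  field_simp
  linear_combination y * h2'

omit [CharZero R] in
/-- A supersingular reduction in residue characteristic two has `b₆ ≠ 0`. -/
lemma b₆_notMem_of_isSupersingular (hΔ : IsUnit W.Δ) (h2 : (2 : R) ∈ maximalIdeal R)
    (h : IsSupersingular 2 (W.map (residue R))) : W.b₆ ∉ maximalIdeal R := by
  have ha := a₁_mem_of_isSupersingular hΔ h2 h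
  intro hb
  refine (mem_maximalIdeal _).1 ?_ hΔ
  have hb2 : W.b₂ ∈ maximalIdeal R := by
    rw [b₂, show W.a₁ ^ 2 + 4 * W.a₂ = W.a₁ * W.a₁ + 2 * (2 * W.a₂) by ring]
    exact Ideal.add_mem _ (Ideal.mul_mem_left _ _ ha) (Ideal.mul_mem_right _ _ h2)
  have hb4 : W.b₄ ∈ maximalIdeal R := by
    rw [b₄]
    exact Ideal.add_mem _ (Ideal.mul_mem_right _ _ h2) (Ideal.mul_mem_right _ _ ha)
  rw [Δ, show -W.b₂ ^ 2 * W.b₈ - 8 * W.b₄ ^ 3 - 27 * W.b₆ ^ 2 + 9 * W.b₂ * W.b₄ * W.b₆ =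
    (-W.b₂ * W.b₈ + 9 * W.b₄ * W.b₆) * W.b₂ + (-8 * W.b₄ ^ 2) * W.b₄ + (-27 * W.b₆) * W.b₆ by
      ring]
  exact Ideal.add_mem _ (Ideal.add_mem _ (Ideal.mul_mem_left _ _ hb2)
    (Ideal.mul_mem_left _ _ hb4)) (Ideal.mul_mem_left _ _ hb)

/-- For supersingular reduction over an unramified base of residue characteristic two there is no
rational `x`-coordinate of a point of order two. -/
theorem Ψ₂Sq_eval_ne_zero_of_isSupersingular {K : Type*} [Field K] [Algebra R K] [IsFractionRing R K]
    (hΔ : IsUnit W.Δ) (h2 : (2 : R) ∈ maximalIdeal R) (h22 : (2 : R) ∉ maximalIdeal R ^ 2)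
    (h : IsSupersingular 2 (W.map (residue R))) (x : K) :
    (W.map (algebraMap R K)).Ψ₂Sq.eval x ≠ 0 := by
  intro hx
  have ha := a₁_mem_of_isSupersingular hΔ h2 h
  -- As `2` is a uniformizer, `a₁` is even, and hence `4 ∣ b₂` and `2 ∣ b₄`.
  have hm : maximalIdeal R = Ideal.span {2} := by
    obtain ⟨ϖ, hϖ⟩ := IsDiscreteValuationRing.exists_irreducible R
    have hmax := hϖ.maximalIdeal_eq
    rw [hmax, Ideal.mem_span_singleton] at h2
    obtain ⟨c, hc⟩ := h2
    have hcu : IsUnit c := by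
      by_contra hcu
      refine h22 ?_
      rw [hc, sq]
      exact Ideal.mul_mem_mul (by rw [hmax]; exact Ideal.mem_span_singleton_self _)
        ((mem_maximalIdeal _).2 hcu)
    rw [hmax, Ideal.span_singleton_eq_span_singleton, hc]
    exact (associated_mul_unit_right _ _ hcu)
  have hb6 := b₆_notMem_of_isSupersingular hΔ h2 h
  obtain ⟨a, ha⟩ : (2 : R) ∣ W.a₁ := by rwa [hm, Ideal.mem_span_singleton] at ha
  have hu : IsUnit W.b₆ := by simpa using hb6
  obtain ⟨v, hv⟩ := hu.exists_right_inv
  set c := a ^ 2 + W.a₂ with hc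
  set d := W.a₄ + a * W.a₃ with hd
  have hb2 : W.b₂ = 4 * c := by rw [b₂, ha]; ring
  have hb4 : W.b₄ = 2 * d := by rw [b₄, ha]; ring
  simp only [Ψ₂Sq, map_b₂, map_b₄, map_b₆, hb2, hb4, map_mul, eval_add, eval_mul, eval_pow, eval_X,
    eval_C, map_ofNat, eval_ofNat] at hx
  have hvK : algebraMap R K W.b₆ * algebraMap R K v = 1 := by rw [← map_mul, hv, map_one]
  have hx0 : x ≠ 0 := by
    rintro rfl
    refine hu.ne_zero (IsFractionRing.injective R K ?_)
    rw [map_zero]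
    linear_combination hx
  -- The equation for `w = x⁻¹`. As `b₆` is a unit, `w` is integral and then divisible by `2`.
  -- Substituting `w = 2z` and dividing by `4` makes `1` a multiple of `2`.
  have hw : algebraMap R K W.b₆ * x⁻¹ ^ 3 + 4 * (1 + algebraMap R K c * x⁻¹ +
      algebraMap R K d * x⁻¹ ^ 2) = 0 := by
    field_simp
    linear_combination hx
  obtain ⟨w, hw'⟩ : ∃ w : R, algebraMap R K w = x⁻¹ := by
    refine IsIntegrallyClosed.isIntegral_iff.1 ⟨X ^ 3 + (C (4 * v * d) * X ^ 2 +
      C (4 * v * c) * X + C (4 * v)), monic_X_pow_add (degree_quadratic_le.trans_lt (by norm_cast)), ?_⟩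
    simp only [eval₂_add, eval₂_mul, eval₂_pow, eval₂_X, eval₂_C, map_mul, eval₂_ofNat,
      map_ofNat]
    linear_combination algebraMap R K v * hw - x⁻¹ ^ 3 * hvK
  rw [← hw'] at hw
  have hwR : W.b₆ * w ^ 3 + 4 * (1 + c * w + d * w ^ 2) = 0 := by
    apply IsFractionRing.injective R K
    simp only [map_add, map_mul, map_pow, map_one, map_zero, map_ofNat]
    exact hw
  have hwm : w ∈ maximalIdeal R := by
    refine (inferInstance : (maximalIdeal R).IsPrime).mem_of_pow_mem 3 ?_
    rw [show w ^ 3 = 2 * (-2 * v * (1 + c * w + d * w ^ 2)) by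
      linear_combination v * hwR - w ^ 3 * hv]
    exact Ideal.mul_mem_right _ _ h2
  obtain ⟨z, rfl⟩ : (2 : R) ∣ w := by rwa [hm, Ideal.mem_span_singleton] at hwm
  have h1 : 1 + 2 * (W.b₆ * z ^ 3 + c * z + 2 * d * z ^ 2) = 0 := by
    refine mul_left_cancel₀ (OfNat.ofNat_ne_zero (R := R) 4) ?_
    linear_combination hwR
  refine (mem_maximalIdeal _).1 h2 (IsUnit.of_mul_eq_one
    (-(W.b₆ * z ^ 3 + c * z + 2 * d * z ^ 2)) ?_)
  linear_combination -h1

end Supersingular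

end WeierstrassCurve

/-! ### Polynomials with Eisenstein reverse -/

section Eisenstein
open IsLocalRing

variable {R : Type*} [CommRing R] [IsDomain R] [IsDiscreteValuationRing R]
  {K L : Type*} [Field K] [Algebra R K] [IsFractionRing R K] [Field L] [Algebra K L] [Algebra R L]
  [IsScalarTower R K L]

/-- The roots of a polynomial whose reverse is an Eisenstein polynomial have full degree. -/
theorem natDegree_minpoly_of_reverse_eisenstein {q : R[X]} (h0 : q.coeff 0 ∉ maximalIdeal R)
    (hq : ∀ i, 0 < i → q.coeff i ∈ maximalIdeal R) (hlead : q.leadingCoeff ∉ maximalIdeal R ^ 2)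
    (hd : 0 < q.natDegree) {x : L} (hx : aeval x q = 0) :
    (minpoly K x).natDegree = q.natDegree := by
  have h00 : q.coeff 0 ≠ 0 := fun h => h0 (h ▸ Ideal.zero_mem _)
  have htr : q.natTrailingDegree = 0 := by
    by_contra h
    exact h00 (coeff_eq_zero_of_lt_natTrailingDegree (Nat.pos_of_ne_zero h))
  have hrd : q.reverse.natDegree = q.natDegree := by rw [reverse_natDegree, htr, Nat.sub_zero]
  have hrl : q.reverse.leadingCoeff = q.coeff 0 := by
    rw [reverse_leadingCoeff, trailingCoeff, htr]
  have hunit : IsUnit q.reverse.leadingCoeff := by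
    rw [hrl]; simpa using h0
  have hprim : q.reverse.IsPrimitive := fun r hr => isUnit_of_dvd_unit
    ((C_dvd_iff_dvd_coeff _ _).1 hr _) hunit
  have hr0 : q.reverse ≠ 0 := fun h => by simp [h] at hunit
  have hirr : Irreducible q.reverse := by
    refine irreducible_of_eisenstein_criterion (P := maximalIdeal R) inferInstance
      (by rwa [hrl]) (fun n hn => ?_) ?_ ?_ hprim
    · rw [degree_eq_natDegree hr0, hrd] at hn
      have hn' : n < q.natDegree := by exact_mod_cast hn
      rw [coeff_reverse, revAt_le hn'.le]
      exact hq _ (by omega)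
    · rw [← natDegree_pos_iff_degree_pos, hrd]; exact hd
    · rwa [coeff_zero_reverse]
  have hirrK := (hprim.irreducible_iff_irreducible_map_fraction_map (K := K)).1 hirr
  have hx0 : x ≠ 0 := by
    rintro rfl
    rw [← coeff_zero_eq_aeval_zero', IsScalarTower.algebraMap_apply R K L] at hx
    simp [h00] at hx
  have hroot : aeval x⁻¹ (q.reverse.map (algebraMap R K)) = 0 := by
    have : Invertible x := invertibleOfNonzero hx0
    rw [aeval_map_algebraMap, ← invOf_eq_inv, aeval_def, eval₂_reverse_eq_zero_iff]
    exact hx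
  have hmin := minpoly.eq_of_irreducible hirrK hroot
  have hinv : (minpoly K x⁻¹).natDegree = q.natDegree := by
    rw [← hmin, natDegree_mul_C (inv_ne_zero (leadingCoeff_ne_zero.2 hirrK.ne_zero)),
      natDegree_map_eq_of_injective (IsFractionRing.injective R K), hrd]
  have hint' : IsIntegral K x⁻¹ := isAlgebraic_iff_isIntegral.1 ⟨_, hirrK.ne_zero, hroot⟩
  have hint : IsIntegral K x := by simpa using hint'.inv
  have hK : IntermediateField.adjoin K {x} = IntermediateField.adjoin K {x⁻¹} := by
    refine le_antisymm ?_ ?_ <;> rw [IntermediateField.adjoin_simple_le_iff]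
    · simpa using inv_mem (IntermediateField.mem_adjoin_simple_self K x⁻¹)
    · exact inv_mem (IntermediateField.mem_adjoin_simple_self K x)
  rw [← hinv, ← IntermediateField.adjoin.finrank hint, ← IntermediateField.adjoin.finrank hint', hK]

end Eisenstein

/-! ### Values of rational functions at geometric points -/

namespace WeierstrassCurve
variable {F : Type*} [Field F] {W : WeierstrassCurve F}

/-- Evaluation of the coordinate ring at a geometric point. -/
noncomputable abbrev geomEval {x y : AlgebraicClosure F}
    (h : (W.map (algebraMap F (AlgebraicClosure F))).toAffine.Equation x y) :
    W.toAffine.CoordinateRing →+* AlgebraicClosure F :=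
  W.coordEval (algebraMap F (AlgebraicClosure F)) h

lemma aevalAeval_eq_geomEval {x y : AlgebraicClosure F}
    (h : (W.map (algebraMap F (AlgebraicClosure F))).toAffine.Equation x y) (g : F[X][Y]) :
    aevalAeval x y g = geomEval h (Affine.CoordinateRing.mk W.toAffine g) := by
  rw [geomEval, coordEval, Affine.CoordinateRing.mk, AdjoinRoot.lift_mk]
  have : (aevalAeval x y : F[X][Y] →ₐ[F] AlgebraicClosure F).toRingHom =
      eval₂RingHom (eval₂RingHom (algebraMap F (AlgebraicClosure F)) x) y := by
    ext <;> simp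
  exact congrArg (fun f : F[X][Y] →+* AlgebraicClosure F => f g) this

/-- On the curve, polynomial values depend only on classes in the coordinate ring, so fractions may
be handled there. -/
lemma hasValueAt_iff {x y : AlgebraicClosure F}
    (h : (W.map (algebraMap F (AlgebraicClosure F))).toAffine.Equation x y)
    {u : W.toAffine.FunctionField} {v : AlgebraicClosure F} :
    W.HasValueAt u x y v ↔ ∃ a b : W.toAffine.CoordinateRing, geomEval h b ≠ 0 ∧
      u * algebraMap _ W.toAffine.FunctionField b = algebraMap _ W.toAffine.FunctionField a ∧
      geomEval h a = v * geomEval h b := by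
  simp only [HasValueAt, aevalAeval_eq_geomEval h]
  constructor
  · rintro ⟨g, k, h1, h2, h3⟩
    exact ⟨_, _, h1, h2, h3⟩
  · rintro ⟨a, b, h1, h2, h3⟩
    obtain ⟨g, rfl⟩ := AdjoinRoot.mk_surjective a
    obtain ⟨k, rfl⟩ := AdjoinRoot.mk_surjective b
    exact ⟨g, k, h1, h2, h3⟩

lemma hasValueAt_algebraMap {x y : AlgebraicClosure F}
    (h : (W.map (algebraMap F (AlgebraicClosure F))).toAffine.Equation x y)
    (a : W.toAffine.CoordinateRing) :
    W.HasValueAt (algebraMap _ W.toAffine.FunctionField a) x y (geomEval h a) :=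
  (hasValueAt_iff h).2 ⟨a, 1, by simp, by simp, by simp⟩

lemma HasValueAt.unique {x y : AlgebraicClosure F}
    (h : (W.map (algebraMap F (AlgebraicClosure F))).toAffine.Equation x y)
    {u : W.toAffine.FunctionField} {v v' : AlgebraicClosure F} (hv : W.HasValueAt u x y v)
    (hv' : W.HasValueAt u x y v') : v = v' := by
  obtain ⟨a, b, h1, h2, h3⟩ := (hasValueAt_iff h).1 hv
  obtain ⟨a', b', h1', h2', h3'⟩ := (hasValueAt_iff h).1 hv'
  have : a * b' = a' * b := by
    apply IsFractionRing.injective W.toAffine.CoordinateRing W.toAffine.FunctionField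
    rw [map_mul, map_mul, ← h2, ← h2']
    ring
  have := congrArg (geomEval h) this
  rw [map_mul, map_mul, h3, h3'] at this
  exact mul_right_cancel₀ (mul_ne_zero h1 h1') (by linear_combination this)

lemma HasValueAt.add {x y : AlgebraicClosure F}
    (h : (W.map (algebraMap F (AlgebraicClosure F))).toAffine.Equation x y)
    {u u' : W.toAffine.FunctionField} {v v' : AlgebraicClosure F} (hv : W.HasValueAt u x y v)
    (hv' : W.HasValueAt u' x y v') : W.HasValueAt (u + u') x y (v + v') := by
  obtain ⟨a, b, h1, h2, h3⟩ := (hasValueAt_iff h).1 hv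
  obtain ⟨a', b', h1', h2', h3'⟩ := (hasValueAt_iff h).1 hv'
  refine (hasValueAt_iff h).2 ⟨a * b' + a' * b, b * b', ?_, ?_, ?_⟩
  · rw [map_mul]; exact mul_ne_zero h1 h1'
  · rw [map_add, map_mul, map_mul, map_mul, ← h2, ← h2']; ring
  · rw [map_add, map_mul, map_mul, map_mul, h3, h3']; ring

lemma HasValueAt.mul {x y : AlgebraicClosure F}
    (h : (W.map (algebraMap F (AlgebraicClosure F))).toAffine.Equation x y)
    {u u' : W.toAffine.FunctionField} {v v' : AlgebraicClosure F} (hv : W.HasValueAt u x y v)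
    (hv' : W.HasValueAt u' x y v') : W.HasValueAt (u * u') x y (v * v') := by
  obtain ⟨a, b, h1, h2, h3⟩ := (hasValueAt_iff h).1 hv
  obtain ⟨a', b', h1', h2', h3'⟩ := (hasValueAt_iff h).1 hv'
  refine (hasValueAt_iff h).2 ⟨a * a', b * b', ?_, ?_, ?_⟩
  · rw [map_mul]; exact mul_ne_zero h1 h1'
  · rw [map_mul, map_mul, ← h2, ← h2']; ring
  · rw [map_mul, map_mul, h3, h3']; ring

lemma HasValueAt.const {x y : AlgebraicClosure F}
    (h : (W.map (algebraMap F (AlgebraicClosure F))).toAffine.Equation x y) (r : F) :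
    W.HasValueAt (algebraMap F _ r) x y (algebraMap F _ r) := by
  have := hasValueAt_algebraMap h (Affine.CoordinateRing.mk W.toAffine (C (C r)))
  rw [geomEval, coordEval_C, eval₂_C] at this
  rwa [IsScalarTower.algebraMap_apply F W.toAffine.CoordinateRing W.toAffine.FunctionField]

lemma HasValueAt.evalPolynomial {x y : AlgebraicClosure F}
    (h : (W.map (algebraMap F (AlgebraicClosure F))).toAffine.Equation x y)
    {u : W.toAffine.FunctionField} {v : AlgebraicClosure F} (hv : W.HasValueAt u x y v)
    (q : F[X]) : W.HasValueAt (Polynomial.aeval u q) x y (Polynomial.aeval v q) := by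
  induction q using Polynomial.induction_on' with
  | add p q hp hq => rw [map_add, map_add]; exact hp.add h hq
  | monomial n r =>
    rw [aeval_monomial, aeval_monomial]
    refine (HasValueAt.const h r).mul h ?_
    induction n with
    | zero => simpa using HasValueAt.const h (1 : F)
    | succ n ih => rw [pow_succ, pow_succ]; exact ih.mul h hv

lemma HasValueAt.evalBivariate {x y : AlgebraicClosure F}
    (h : (W.map (algebraMap F (AlgebraicClosure F))).toAffine.Equation x y)
    {u u' : W.toAffine.FunctionField} {v v' : AlgebraicClosure F} (hv : W.HasValueAt u x y v)
    (hv' : W.HasValueAt u' x y v') (q : F[X][Y]) :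
    W.HasValueAt (Polynomial.aevalAeval u u' q) x y (Polynomial.aevalAeval v v' q) := by
  induction q using Polynomial.induction_on' with
  | add p q hp hq => rw [map_add, map_add]; exact hp.add h hq
  | monomial n r =>
    rw [← C_mul_X_pow_eq_monomial, map_mul, map_mul, map_pow, map_pow]
    simp only [aevalAeval_C, aevalAeval_Y]
    refine (HasValueAt.evalPolynomial h hv r).mul h ?_
    induction n with
    | zero => simpa using HasValueAt.const h (1 : F)
    | succ n ih => rw [pow_succ, pow_succ]; exact ih.mul h hv'

lemma HasValueAt.galois (σ : AlgebraicClosure F →ₐ[F] AlgebraicClosure F)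
    {x y v : AlgebraicClosure F} {u : W.toAffine.FunctionField} (hv : W.HasValueAt u x y v) :
    W.HasValueAt u (σ x) (σ y) (σ v) := by
  have key (g : F[X][Y]) : aevalAeval (σ x) (σ y) g = σ (aevalAeval x y g) := by
    have : (aevalAeval (σ x) (σ y) : F[X][Y] →ₐ[F] AlgebraicClosure F) =
        σ.comp (aevalAeval x y) := by
      refine Polynomial.algHom_ext' ?_ ?_
      · ext; simp
      · simp
    rw [this]; rfl
  obtain ⟨g, k, h1, h2, h3⟩ := hv
  refine ⟨g, k, ?_, h2, ?_⟩
  · rw [key]; exact (map_ne_zero_iff _ σ.injective).2 h1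
  · rw [key, key, h3, map_mul]

/-- A nonzero rational function vanishes at points with finitely many abscissas. -/
lemma finite_hasValueAt_zero {u : W.toAffine.FunctionField} (hu : u ≠ 0) :
    {x | ∃ y, (W.map (algebraMap F (AlgebraicClosure F))).toAffine.Equation x y ∧
      W.HasValueAt u x y 0}.Finite := by
  obtain ⟨n, m, hm, rfl⟩ := IsFractionRing.div_surjective (A := W.toAffine.CoordinateRing) u
  have hn : n ≠ 0 := by rintro rfl; simp at hu
  have hmK : algebraMap W.toAffine.CoordinateRing W.toAffine.FunctionField m ≠ 0 :=
    IsFractionRing.to_map_ne_zero_of_mem_nonZeroDivisors hm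
  have : Module.Finite F[X] W.toAffine.CoordinateRing :=
    Module.Finite.of_basis (Affine.CoordinateRing.basis W.toAffine)
  -- The numerator divides a nonzero polynomial in `X` alone, whose roots contain the abscissas of
  -- all zeros.
  obtain ⟨r, hr, s, hs⟩ := (Algebra.IsAlgebraic.isAlgebraic (R := F[X]) n).exists_nonzero_dvd
    (mem_nonZeroDivisors_of_ne_zero hn)
  refine ((r.map (algebraMap F (AlgebraicClosure F))).rootSet_finite
    (AlgebraicClosure F)).subset ?_
  rintro x ⟨y, h, hv⟩
  obtain ⟨a, b, h1, h2, h3⟩ := (hasValueAt_iff h).1 hv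
  have e : n * b = m * a := by
    apply IsFractionRing.injective W.toAffine.CoordinateRing W.toAffine.FunctionField
    rw [map_mul, map_mul, ← h2]
    field_simp
  have e' := congrArg (geomEval h) e
  rw [map_mul, map_mul, h3, zero_mul, mul_zero, mul_eq_zero, or_iff_left h1] at e'
  rw [mem_rootSet]
  refine ⟨(Polynomial.map_ne_zero_iff (algebraMap F _).injective).2 hr, ?_⟩
  have e2 := congrArg (geomEval h) hs
  rw [map_mul, e', zero_mul] at e2
  rw [aeval_map_algebraMap, ← e2]
  change _ = geomEval h (Affine.CoordinateRing.mk W.toAffine (C r))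
  rw [geomEval, coordEval_C]
  rfl

end WeierstrassCurve

/-! ### Galois stability of the kernel and the upper bound for its order -/

namespace WeierstrassCurve

namespace Affine.Point
variable {K : Type*} [Field K] {W : Affine K}

/-- The ordinate of a point, with the junk value `0` at infinity. -/
noncomputable def yCoord : W.Point → K
  | 0 => 0
  | some _ y _ => y

lemma equation_coords {P : W.Point} (hP : P ≠ 0) : W.Equation (xCoord P) (yCoord P) := by
  rcases P with _ | ⟨x, y, h⟩
  · exact absurd rfl hP
  · exact h.1

lemma eq_of_coords {P Q : W.Point} (hP : P ≠ 0) (hQ : Q ≠ 0) (hx : xCoord P = xCoord Q)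
    (hy : yCoord P = yCoord Q) : P = Q := by
  rcases P with _ | ⟨x, y, h⟩
  · exact absurd rfl hP
  rcases Q with _ | ⟨x', y', h'⟩
  · exact absurd rfl hQ
  change x = x' at hx
  change y = y' at hy
  subst hx hy
  rfl

variable [DecidableEq K]

lemma finite_setOf_xCoord_mem {s : Set K} (hs : s.Finite) : {P : W.Point | xCoord P ∈ s}.Finite := by
  refine hs.preimage' fun c _ => ?_
  by_cases h : ∃ P : W.Point, P ≠ 0 ∧ xCoord P = c
  · obtain ⟨P, hP, rfl⟩ := h
    refine (Set.toFinite {0, P, -P}).subset fun Q hQ => ?_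
    by_cases hQ0 : Q = 0
    · simp [hQ0]
    · exact Or.inr ((xCoord_eq_iff hQ0 hP).1 hQ)
  · push Not at h
    exact (Set.toFinite {0}).subset fun Q hQ => by_contra fun hQ0 => h Q hQ0 hQ

lemma finite_setOf_add_self_mem (h4 : (4 : K) ≠ 0) {s : Set W.Point} (hs : s.Finite) :
    {P : W.Point | P + P ∈ s}.Finite := by
  have h2 : {P : W.Point | P + P = 0}.Finite := by
    have hfin := (W.Ψ₂Sq).rootSet_finite K
    refine ((finite_setOf_xCoord_mem hfin).union (Set.finite_singleton 0)).subset fun P hP => ?_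
    by_cases hP0 : P = 0
    · exact Or.inr hP0
    refine Or.inl ((mem_rootSet).2 ⟨Ψ₂Sq_ne_zero W h4, ?_⟩)
    rw [coe_aeval_eq_eval, ← etaCoord_sq hP0, (etaCoord_eq_zero_iff hP0).2 hP, sq, mul_zero]
  refine hs.preimage' fun c _ => ?_
  by_cases h : ∃ P : W.Point, P + P = c
  · obtain ⟨P, rfl⟩ := h
    refine (h2.image (P + ·)).subset fun Q hQ => ⟨Q - P, ?_, by simp⟩
    change Q + Q = P + P at hQ
    change Q - P + (Q - P) = 0
    rw [sub_add_sub_comm, hQ, sub_self]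
  · push Not at h
    exact Set.finite_empty.subset fun Q hQ => h Q hQ

omit [DecidableEq K] in
lemma xCoord_surjective [IsAlgClosed K] [W.IsElliptic] :
    Function.Surjective (xCoord : W.Point → K) := fun x => by
  obtain ⟨y, hy⟩ := Affine.exists_equation W x
  exact ⟨some x y ((equation_iff_nonsingular).1 hy), rfl⟩

end Affine.Point

open Affine.Point hiding map_zero

variable {F : Type*} [Field F] {W W' : WeierstrassCurve F}

open scoped Classical in
/-- The action of an endomorphism of the algebraic closure on geometric points. -/
noncomputable def galoisMap (W : WeierstrassCurve F)
    (σ : AlgebraicClosure F →ₐ[F] AlgebraicClosure F) : W.GeomPoint →+ W.GeomPoint :=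
  Affine.Point.map (W' := W.toAffine) (S := F) σ

lemma galoisMap_injective (σ : AlgebraicClosure F →ₐ[F] AlgebraicClosure F) :
    Function.Injective (galoisMap W σ) := by
  classical
  exact Affine.Point.map_injective (W' := W.toAffine) (S := F) σ

lemma xCoord_galoisMap (σ : AlgebraicClosure F →ₐ[F] AlgebraicClosure F) (P : W.GeomPoint) :
    xCoord (galoisMap W σ P) = σ (xCoord P) := by
  rcases P with _ | ⟨x, y, h⟩
  · exact (map_zero σ).symm
  · rfl

lemma yCoord_galoisMap (σ : AlgebraicClosure F →ₐ[F] AlgebraicClosure F) (P : W.GeomPoint) :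
    yCoord (galoisMap W σ P) = σ (yCoord P) := by
  rcases P with _ | ⟨x, y, h⟩
  · exact (map_zero σ).symm
  · rfl

lemma infinite_geomPoint [W.IsElliptic] : Infinite W.GeomPoint := by
  classical
  exact Infinite.of_surjective (xCoord : W.GeomPoint → AlgebraicClosure F) xCoord_surjective

variable {φ : W.GeomPoint →+ W'.GeomPoint} {f g : W.toAffine.FunctionField}

lemma IsGivenBy.hasValueAt (h : IsGivenBy φ f g) {P : W.GeomPoint} (hP : φ P ≠ 0) :
    W.HasValueAt f (xCoord P) (yCoord P) (xCoord (φ P)) ∧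
      W.HasValueAt g (xCoord P) (yCoord P) (yCoord (φ P)) := by
  rcases P with _ | ⟨x, y, hxy⟩
  · exact absurd (map_zero φ) hP
  · rcases hQ : φ (.some x y hxy) with _ | ⟨x', y', hxy'⟩
    · exact absurd hQ hP
    · exact h x y hxy x' y' hxy' hQ

/-- The functions `f`, `g` say nothing at points of the kernel, so `P` is moved away by a general
`Q`. Since `φ (Q + P) = φ Q`, conjugating values gives `φ (σ (Q + P)) = φ (σ Q)`, and subtraction
gives the claim. -/
lemma galoisMap_mem_ker [W.IsElliptic] (hfin : (φ.ker : Set W.GeomPoint).Finite)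
    (h : IsGivenBy φ f g) (σ : AlgebraicClosure F →ₐ[F] AlgebraicClosure F) {P : W.GeomPoint}
    (hP : P ∈ φ.ker) : galoisMap W σ P ∈ φ.ker := by
  have := infinite_geomPoint (W := W)
  have hf1 : {Q | galoisMap W σ Q ∈ φ.ker}.Finite :=
    hfin.preimage (galoisMap_injective σ).injOn
  have hf2 : {Q | galoisMap W σ (Q + P) ∈ φ.ker}.Finite :=
    hfin.preimage (((galoisMap_injective σ).comp (add_left_injective P)).injOn)
  obtain ⟨Q, hQ⟩ := ((hfin.union hf1).union hf2).exists_notMem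
  simp only [Set.mem_union, not_or, Set.mem_ofPred_eq, SetLike.mem_coe, AddMonoidHom.mem_ker] at hQ
  obtain ⟨⟨hQ0, hQ1⟩, hQ2⟩ := hQ
  have hQP : φ (Q + P) = φ Q := by rw [map_add, (hP : φ P = 0), add_zero]
  obtain ⟨a1, b1⟩ := h.hasValueAt hQ0
  obtain ⟨a2, b2⟩ := h.hasValueAt (hQP ▸ hQ0)
  rw [hQP] at a2 b2
  obtain ⟨a3, b3⟩ := h.hasValueAt hQ1
  obtain ⟨a4, b4⟩ := h.hasValueAt hQ2
  replace a1 := a1.galois σ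
  replace a2 := a2.galois σ
  replace b1 := b1.galois σ
  replace b2 := b2.galois σ
  rw [← xCoord_galoisMap, ← yCoord_galoisMap] at a1 a2 b1 b2
  have e1 := equation_coords (P := galoisMap W σ Q) (fun h0 => hQ1 (by rw [h0, map_zero]))
  have e2 := equation_coords (P := galoisMap W σ (Q + P)) (fun h0 => hQ2 (by rw [h0, map_zero]))
  have key : φ (galoisMap W σ Q) = φ (galoisMap W σ (Q + P)) :=
    eq_of_coords hQ1 hQ2 ((a3.unique e1 a1).trans (a2.unique e2 a4))
      ((b3.unique e1 b1).trans (b2.unique e2 b4))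
  rw [map_add, map_add] at key
  exact (left_eq_add.1 key)

lemma HasValueAt.sum {x y : AlgebraicClosure F}
    (h : (W.map (algebraMap F (AlgebraicClosure F))).toAffine.Equation x y) {ι : Type*}
    (s : Finset ι) {u : ι → W.toAffine.FunctionField} {v : ι → AlgebraicClosure F}
    (hv : ∀ i, W.HasValueAt (u i) x y (v i)) :
    W.HasValueAt (∑ i ∈ s, u i) x y (∑ i ∈ s, v i) := by
  classical
  induction s using Finset.induction_on with
  | empty => simpa using HasValueAt.const h (0 : F)
  | insert i s hi ih => rw [Finset.sum_insert hi, Finset.sum_insert hi]; exact (hv i).add h ih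

open scoped IntermediateField.algebraAdjoinAdjoin in
/-- Clearing denominators in the minimal polynomial over `F(f, g)`. -/
lemma exists_relation_of_finiteDimensional_adjoin {K : Type*} [Field K] [Algebra F K] (f g x : K)
    [FiniteDimensional (IntermediateField.adjoin F ({f, g} : Set K)) K] :
    ∃ (d : ℕ) (c : ℕ → F[X][Y]),
      d ≤ Module.finrank (IntermediateField.adjoin F ({f, g} : Set K)) K ∧
      aevalAeval f g (c d) ≠ 0 ∧ ∑ i ∈ Finset.range (d + 1), aevalAeval f g (c i) * x ^ i = 0 := by
  set L := IntermediateField.adjoin F ({f, g} : Set K)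
  set A := Algebra.adjoin F ({f, g} : Set K)
  have hx : _root_.IsIntegral L x := Algebra.IsIntegral.isIntegral x
  set m := minpoly L x with hm
  obtain ⟨b, hb⟩ := IsLocalization.exist_integer_multiples (nonZeroDivisors A)
    (Finset.range (m.natDegree + 1)) m.coeff
  have hA : A ≤ (aevalAeval f g : F[X][Y] →ₐ[F] K).range := by
    refine Algebra.adjoin_le ?_
    rintro z (rfl | rfl)
    · exact ⟨C X, aevalAeval_X _ _⟩
    · exact ⟨Y, aevalAeval_Y _ _⟩
  have hc (i : ℕ) : ∃ c : F[X][Y], i ∈ Finset.range (m.natDegree + 1) →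
      aevalAeval f g c = (b : K) * (m.coeff i : K) := by
    by_cases hi : i ∈ Finset.range (m.natDegree + 1)
    · obtain ⟨a, ha⟩ := hb i hi
      obtain ⟨c, hc⟩ := hA a.2
      refine ⟨c, fun _ => hc.trans ?_⟩
      exact congrArg (fun z : L => (z : K)) ha
    · exact ⟨0, fun h => absurd h hi⟩
  choose c hc using hc
  have hb0 : ((b : A) : K) ≠ 0 := by
    have := nonZeroDivisors.coe_ne_zero b
    exact fun h => this (Subtype.ext h)
  refine ⟨m.natDegree, c, minpoly.natDegree_le x, ?_, ?_⟩
  · rw [hc _ (by simp), show m.coeff m.natDegree = 1 from minpoly.monic hx]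
    simp [hb0]
  · have h0 := minpoly.aeval L x
    rw [aeval_eq_sum_range] at h0
    rw [← mul_zero (b : K), ← h0, Finset.mul_sum]
    refine Finset.sum_congr rfl fun i hi => ?_
    rw [hc i hi, mul_assoc]
    rfl

/-- The translates `P + T` of a general `P` by the kernel share the values of `f` and `g`. The
equation of `x` over `F(f, g)` therefore specializes to a single polynomial having all their
abscissas as roots. -/
lemma card_ker_le [CharZero F] [W.IsElliptic] (hfin : (φ.ker : Set W.GeomPoint).Finite)
    (h : IsGivenBy φ f g) (hd : ratMapDegree f g ≠ 0) :
    Nat.card φ.ker ≤ ratMapDegree f g := by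
  classical
  have := infinite_geomPoint (W := W)
  have : FiniteDimensional (IntermediateField.adjoin F ({f, g} : Set W.toAffine.FunctionField))
    W.toAffine.FunctionField := Module.finite_of_finrank_pos (Nat.pos_of_ne_zero hd)
  obtain ⟨d, c, hdle, hc0, hc⟩ := exists_relation_of_finiteDimensional_adjoin (F := F) f g
    (algebraMap W.toAffine.CoordinateRing W.toAffine.FunctionField
      (Affine.CoordinateRing.mk W.toAffine (C X)))
  have hf1 := finite_setOf_xCoord_mem
    (W := (W.map (algebraMap F (AlgebraicClosure F))).toAffine) (finite_hasValueAt_zero hc0)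
  have h4 : (4 : AlgebraicClosure F) ≠ 0 := by
    have : CharZero (AlgebraicClosure F) :=
      charZero_of_injective_algebraMap (algebraMap F _).injective
    exact OfNat.ofNat_ne_zero 4
  have hf2 := finite_setOf_add_self_mem h4 hfin
  -- Three conditions on `P`: its image is affine, the leading coefficient does not vanish there,
  -- and `2P` is outside the kernel. The last one prevents `P + T = -(P + T')`, so abscissas
  -- separate the translates.
  obtain ⟨P, hP⟩ := ((hfin.union hf1).union hf2).exists_notMem
  simp only [Set.mem_union, not_or, Set.mem_ofPred_eq, SetLike.mem_coe, AddMonoidHom.mem_ker,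
    not_exists, not_and] at hP
  obtain ⟨⟨hP0, hP1⟩, hP2⟩ := hP
  have hadd (T : φ.ker) : φ (P + T) = φ P := by rw [map_add, (T.2 : φ T = 0), add_zero]
  have hne (T : φ.ker) : P + (T : W.GeomPoint) ≠ 0 := fun h0 => hP0 (by rw [← hadd T, h0, map_zero])
  set a := xCoord (φ P)
  set b := yCoord (φ P)
  have hval (T : φ.ker) (q : F[X][Y]) : W.HasValueAt (aevalAeval f g q) (xCoord (P + T : W.GeomPoint))
      (yCoord (P + T : W.GeomPoint)) (aevalAeval a b q) := by
    obtain ⟨h1, h2⟩ := h.hasValueAt (P := P + T) (by rwa [hadd])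
    rw [hadd] at h1 h2
    exact HasValueAt.evalBivariate (equation_coords (hne T)) h1 h2 q
  set Q : (AlgebraicClosure F)[X] := ∑ i ∈ Finset.range (d + 1), C (aevalAeval a b (c i)) * X ^ i
  have hQd : Q.coeff d ≠ 0 := by
    have : Q.coeff d = aevalAeval a b (c d) := by
      simp [Q, coeff_X_pow]
    rw [this]
    intro h0
    have := hval 0 (c d)
    rw [h0] at this
    simp only [ZeroMemClass.coe_zero, add_zero] at this
    refine hP1 _ (equation_coords ?_) this
    rintro rfl
    exact hP0 (map_zero φ)
  have hQ0 : Q ≠ 0 := fun h0 => hQd (by rw [h0, coeff_zero])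
  have hQdeg : Q.natDegree ≤ d := natDegree_sum_le_of_forall_le _ _ fun i hi =>
    (natDegree_C_mul_X_pow_le _ _).trans (Nat.lt_succ_iff.1 (Finset.mem_range.1 hi))
  have hroot (T : φ.ker) : xCoord (P + T : W.GeomPoint) ∈ Q.rootSet (AlgebraicClosure F) := by
    have he := equation_coords (hne T)
    have hx : W.HasValueAt (algebraMap W.toAffine.CoordinateRing W.toAffine.FunctionField
        (Affine.CoordinateRing.mk W.toAffine (C X))) (xCoord (P + T : W.GeomPoint))
        (yCoord (P + T : W.GeomPoint)) (xCoord (P + T : W.GeomPoint)) := by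
      have := hasValueAt_algebraMap he (Affine.CoordinateRing.mk W.toAffine (C X))
      rwa [geomEval, coordEval_C, eval₂_X] at this
    have hs := HasValueAt.sum he (Finset.range (d + 1)) fun i =>
      (hval T (c i)).mul he (HasValueAt.evalPolynomial he hx (X ^ i))
    simp only [map_pow, aeval_X] at hs
    rw [hc] at hs
    have h00 := HasValueAt.const he (0 : F)
    rw [map_zero, map_zero] at h00
    rw [mem_rootSet]
    refine ⟨hQ0, ?_⟩
    rw [h00.unique he hs]
    simp [Q]
  have hinj : Function.Injective fun T : φ.ker =>
      (⟨_, hroot T⟩ : Q.rootSet (AlgebraicClosure F)) := by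
    intro T T' hT
    rcases (xCoord_eq_iff (hne T) (hne T')).1 (congrArg Subtype.val hT) with hT | hT
    · exact Subtype.ext (add_left_cancel hT)
    · exfalso
      apply hP2
      have := congrArg φ hT
      rw [map_neg, hadd, hadd, ← add_eq_zero_iff_eq_neg] at this
      rw [map_add, this]
  calc Nat.card φ.ker ≤ Nat.card (Q.rootSet (AlgebraicClosure F)) :=
        Nat.card_le_card_of_injective _ hinj
    _ ≤ Q.natDegree := by
        rw [Nat.card_coe_set_eq]
        exact ncard_rootSet_le Q _
    _ ≤ _ := hQdeg.trans hdle

end WeierstrassCurve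

/-! ### Specialization of embeddings and the lower bound for the kernel -/

/-- A nonzero algebra of finite type over a field has a point over the algebraic closure. -/
lemma nonempty_algHom_algebraicClosure (F A : Type*) [Field F] [CommRing A] [Nontrivial A]
    [Algebra F A] [Algebra.FiniteType F A] : Nonempty (A →ₐ[F] AlgebraicClosure F) := by
  obtain ⟨m, hm⟩ := Ideal.exists_maximal A
  let := Ideal.Quotient.field m
  have := finite_of_finite_type_of_isJacobsonRing F (A ⧸ m)
  exact ⟨(IsAlgClosed.lift (R := F) (S := A ⧸ m)).comp (Ideal.Quotient.mkₐ F m)⟩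

/-- Finitely many elements of an extension field can be specialized to the algebraic closure. -/
lemma nonempty_algHom_adjoin_algebraicClosure {F Ω : Type*} [Field F] [Field Ω] [Algebra F Ω]
    {S : Set Ω} (hS : S.Finite) :
    Nonempty (Algebra.adjoin F S →ₐ[F] AlgebraicClosure F) := by
  have : Algebra.FiniteType F (Algebra.adjoin F S) :=
    (Subalgebra.fg_iff_finiteType _).1 (Subalgebra.fg_def.2 ⟨S, hS, rfl⟩)
  exact nonempty_algHom_algebraicClosure F _

lemma aevalAeval_algHom {F A B : Type*} [CommRing F] [CommRing A] [CommRing B] [Algebra F A]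
    [Algebra F B] (θ : A →ₐ[F] B) (x y : A) (q : F[X][Y]) :
    aevalAeval (θ x) (θ y) q = θ (aevalAeval x y q) := by
  have : (aevalAeval (θ x) (θ y) : F[X][Y] →ₐ[F] B) = θ.comp (aevalAeval x y) := by
    refine Polynomial.algHom_ext' ?_ ?_
    · ext; simp
    · simp
  rw [this]; rfl

/-- A homomorphism out of a subalgebra does not kill elements that are invertible there. -/
lemma AlgHom.ne_zero_of_inv_mem {F Ω B : Type*} [Field F] [Field Ω] [Algebra F Ω] [CommRing B]
    [Nontrivial B] [Algebra F B] {R : Subalgebra F Ω} (ρ : R →ₐ[F] B) {z : R} (hz : (z : Ω) ≠ 0)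
    (hi : (z : Ω)⁻¹ ∈ R) : ρ z ≠ 0 := by
  have h1 : z * ⟨_, hi⟩ = 1 := Subtype.ext (mul_inv_cancel₀ hz)
  exact ((IsUnit.of_mul_eq_one _ h1).map ρ).ne_zero

namespace WeierstrassCurve
open Affine.Point hiding map_zero

variable {F : Type*} [Field F] {W W' : WeierstrassCurve F}

/-- The coordinate function `x` of `W`. -/
noncomputable def xFun (W : WeierstrassCurve F) : W.toAffine.FunctionField :=
  algebraMap W.toAffine.CoordinateRing _ (Affine.CoordinateRing.mk W.toAffine (C X))

/-- The coordinate function `y` of `W`. -/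
noncomputable def yFun (W : WeierstrassCurve F) : W.toAffine.FunctionField :=
  algebraMap W.toAffine.CoordinateRing _ (Affine.CoordinateRing.mk W.toAffine Y)

lemma aevalAeval_xFun_yFun (q : F[X][Y]) :
    aevalAeval W.xFun W.yFun q = algebraMap W.toAffine.CoordinateRing W.toAffine.FunctionField
      (Affine.CoordinateRing.mk W.toAffine q) := by
  let θ : F[X][Y] →ₐ[F] W.toAffine.FunctionField :=
    (IsScalarTower.toAlgHom F W.toAffine.CoordinateRing W.toAffine.FunctionField).comp
      ((AdjoinRoot.mkₐ W.toAffine.polynomial).restrictScalars F)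
  have h := aevalAeval_algHom θ (C X) Y q
  have h2 : (aevalAeval (C X) Y : F[X][Y] →ₐ[F] F[X][Y]) = AlgHom.id F _ := by
    refine Polynomial.algHom_ext' ?_ ?_
    · ext; simp
    · simp
  rw [h2] at h
  exact h

lemma aeval_xFun_ne_zero {q : F[X]} (hq : q ≠ 0) : aeval W.xFun q ≠ 0 := by
  have h := aevalAeval_xFun_yFun (W := W) (C q)
  rw [aevalAeval_C] at h
  rw [h]
  refine (map_ne_zero_iff _ (IsFractionRing.injective W.toAffine.CoordinateRing
    W.toAffine.FunctionField)).2 ?_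
  exact (map_ne_zero_iff _ (FaithfulSMul.algebraMap_injective F[X] W.toAffine.CoordinateRing)).2 hq

lemma functionField_algHom_ext {Ω : Type*} [Field Ω] [Algebra F Ω]
    {σ τ : W.toAffine.FunctionField →ₐ[F] Ω} (hx : σ W.xFun = τ W.xFun)
    (hy : σ W.yFun = τ W.yFun) : σ = τ := by
  have : (σ : W.toAffine.FunctionField →+* Ω) = τ := by
    refine IsLocalization.ringHom_ext (nonZeroDivisors W.toAffine.CoordinateRing) ?_
    refine RingHom.ext fun a => ?_
    obtain ⟨q, rfl⟩ := AdjoinRoot.mk_surjective a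
    have h1 := aevalAeval_algHom σ W.xFun W.yFun q
    have h2 := aevalAeval_algHom τ W.xFun W.yFun q
    rw [aevalAeval_xFun_yFun] at h1 h2
    rw [hx, hy, h2] at h1
    exact h1.symm
  exact AlgHom.coe_ringHom_injective this

lemma equation_iff_aevalAeval {x y : AlgebraicClosure F} :
    (W.map (algebraMap F (AlgebraicClosure F))).toAffine.Equation x y ↔
      aevalAeval x y W.toAffine.polynomial = 0 := by
  have : (evalEvalRingHom x y).comp (mapRingHom (mapRingHom (algebraMap F (AlgebraicClosure F)))) =
      (aevalAeval x y : F[X][Y] →ₐ[F] AlgebraicClosure F).toRingHom := by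
    ext <;> simp
  have h2 := congrArg (fun θ : F[X][Y] →+* AlgebraicClosure F => θ W.toAffine.polynomial) this
  rw [Affine.Equation, show (aevalAeval x y) W.toAffine.polynomial = _ from h2.symm]
  change (evalEval x y (Affine.polynomial (W.map (algebraMap F (AlgebraicClosure F))))) = 0 ↔ _
  rw [Affine.map_polynomial]
  rfl

section Specialization

variable {Ω : Type*} [Field Ω] [Algebra F Ω] (σ : W.toAffine.FunctionField →ₐ[F] Ω)
  {R : Subalgebra F Ω} (ρ : R →ₐ[F] AlgebraicClosure F) (hx : σ W.xFun ∈ R) (hy : σ W.yFun ∈ R)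

include hx hy in
lemma coe_aevalAeval_specialization (q : F[X][Y]) :
    ((aevalAeval (⟨_, hx⟩ : R) ⟨_, hy⟩ q : R) : Ω) =
      σ (algebraMap W.toAffine.CoordinateRing _ (Affine.CoordinateRing.mk W.toAffine q)) := by
  rw [← aevalAeval_xFun_yFun, ← aevalAeval_algHom σ]
  exact (aevalAeval_algHom R.val (⟨_, hx⟩ : R) ⟨_, hy⟩ q).symm

lemma equation_specialization :
    (W.map (algebraMap F (AlgebraicClosure F))).toAffine.Equation (ρ ⟨_, hx⟩) (ρ ⟨_, hy⟩) := by
  rw [equation_iff_aevalAeval, aevalAeval_algHom]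
  have : aevalAeval (⟨_, hx⟩ : R) ⟨_, hy⟩ W.toAffine.polynomial = 0 := by
    apply Subtype.ext
    rw [coe_aevalAeval_specialization, show Affine.CoordinateRing.mk W.toAffine _ = 0 from
      AdjoinRoot.mk_self, map_zero, map_zero]
    rfl
  rw [this, map_zero]

/-- An embedding `σ` is a point over `Ω`, and `ρ` specializes it to a geometric point. Having the
inverse of the denominator in `R` keeps `u` regular there. -/
lemma hasValueAt_specialization {u : W.toAffine.FunctionField} (hu : σ u ∈ R) {q : F[X][Y]}
    {d : F[X][Y]} (hd : Affine.CoordinateRing.mk W.toAffine d ≠ 0)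
    (hq : u * algebraMap _ W.toAffine.FunctionField (Affine.CoordinateRing.mk W.toAffine d) =
      algebraMap _ W.toAffine.FunctionField (Affine.CoordinateRing.mk W.toAffine q))
    (hi : (σ (algebraMap W.toAffine.CoordinateRing _ (Affine.CoordinateRing.mk W.toAffine d)))⁻¹ ∈ R) :
    W.HasValueAt u (ρ ⟨_, hx⟩) (ρ ⟨_, hy⟩) (ρ ⟨_, hu⟩) := by
  refine ⟨q, d, ?_, hq, ?_⟩
  · rw [aevalAeval_algHom]
    refine ρ.ne_zero_of_inv_mem ?_ ?_
    · rw [coe_aevalAeval_specialization]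
      exact (map_ne_zero_iff _ σ.injective).2 ((map_ne_zero_iff _ (IsFractionRing.injective _ _)).2 hd)
    · rwa [coe_aevalAeval_specialization]
  · rw [aevalAeval_algHom, aevalAeval_algHom, ← map_mul]
    congr 1
    apply Subtype.ext
    rw [MulMemClass.coe_mul, coe_aevalAeval_specialization, coe_aevalAeval_specialization, ← map_mul, hq]

end Specialization

variable {φ : W.GeomPoint →+ W'.GeomPoint} {f g : W.toAffine.FunctionField}

lemma exists_mk_mul_eq (u : W.toAffine.FunctionField) : ∃ q d : F[X][Y],
    Affine.CoordinateRing.mk W.toAffine d ≠ 0 ∧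
    u * algebraMap _ W.toAffine.FunctionField (Affine.CoordinateRing.mk W.toAffine d) =
      algebraMap _ W.toAffine.FunctionField (Affine.CoordinateRing.mk W.toAffine q) := by
  obtain ⟨n, m, hm, rfl⟩ := IsFractionRing.div_surjective (A := W.toAffine.CoordinateRing) u
  obtain ⟨q, rfl⟩ := AdjoinRoot.mk_surjective n
  obtain ⟨d, rfl⟩ := AdjoinRoot.mk_surjective m
  exact ⟨q, d, nonZeroDivisors.ne_zero hm,
    div_mul_cancel₀ _ (IsFractionRing.to_map_ne_zero_of_mem_nonZeroDivisors hm)⟩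

/-- By separability the degree counts the embeddings of `F(W)` over `F(f, g)`. A common
specialization turns them into distinct geometric points with equal values of `f`, `g`, hence equal
image under `φ`; their differences from a fixed one lie in the kernel. -/
lemma ratMapDegree_le_card_ker [CharZero F] [W.IsElliptic]
    (hfin : (φ.ker : Set W.GeomPoint).Finite) (h : IsGivenBy φ f g) (hd : ratMapDegree f g ≠ 0) :
    ratMapDegree f g ≤ Nat.card φ.ker := by
  classical
  let L := IntermediateField.adjoin F ({f, g} : Set W.toAffine.FunctionField)
  let Ω := AlgebraicClosure W.toAffine.FunctionField
  have : FiniteDimensional L W.toAffine.FunctionField :=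
    Module.finite_of_finrank_pos (Nat.pos_of_ne_zero hd)
  have : CharZero L := charZero_of_injective_algebraMap (algebraMap F L).injective
  have hcard : Fintype.card (W.toAffine.FunctionField →ₐ[L] Ω) = ratMapDegree f g :=
    AlgHom.card L W.toAffine.FunctionField Ω
  let res (σ : W.toAffine.FunctionField →ₐ[L] Ω) : W.toAffine.FunctionField →ₐ[F] Ω :=
    σ.restrictScalars F
  obtain ⟨qf, df, hdf, hf⟩ := exists_mk_mul_eq f
  obtain ⟨qg, dg, hdg, hg⟩ := exists_mk_mul_eq g
  -- Keeping `r(x)` invertible during the specialization forces the points obtained to lie outside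
  -- the kernel.
  obtain ⟨r, hr0, hr⟩ : ∃ r : F[X], r ≠ 0 ∧ ∀ T ∈ φ.ker, aeval (xCoord T) r = 0 := by
    refine ⟨∏ T ∈ hfin.toFinset, minpoly F (xCoord T), Finset.prod_ne_zero_iff.2 fun T _ =>
      minpoly.ne_zero (Algebra.IsIntegral.isIntegral _), fun T hT => ?_⟩
    rw [map_prod]
    exact Finset.prod_eq_zero (hfin.mem_toFinset.2 hT) (minpoly.aeval F _)
  let am (d : F[X][Y]) : W.toAffine.FunctionField :=
    algebraMap _ W.toAffine.FunctionField (Affine.CoordinateRing.mk W.toAffine d)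
  -- Besides the coordinates, `S` contains inverses of everything that must stay nonzero:
  -- denominators, `r(x)` and differences of coordinates. A vanishing difference contributes only
  -- `0⁻¹ = 0`.
  let S : Set Ω := {algebraMap _ Ω f, algebraMap _ Ω g} ∪
    (Set.range (fun σ => res σ W.xFun) ∪ (Set.range (fun σ => res σ W.yFun) ∪
    (Set.range (fun σ => (res σ (am df))⁻¹) ∪ (Set.range (fun σ => (res σ (am dg))⁻¹) ∪
    (Set.range (fun σ => (res σ (aeval W.xFun r))⁻¹) ∪
    (Set.range (fun σ : _ × _ => (res σ.1 W.xFun - res σ.2 W.xFun)⁻¹) ∪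
      Set.range (fun σ : _ × _ => (res σ.1 W.yFun - res σ.2 W.yFun)⁻¹)))))))
  have hS : S.Finite := Set.toFinite S
  obtain ⟨ρ⟩ := nonempty_algHom_adjoin_algebraicClosure (F := F) hS
  have hmem {z : Ω} (hz : z ∈ S) : z ∈ Algebra.adjoin F S := Algebra.subset_adjoin hz
  have mf : algebraMap _ Ω f ∈ Algebra.adjoin F S :=
    hmem <| .inl <| .inl rfl
  have mg : algebraMap _ Ω g ∈ Algebra.adjoin F S :=
    hmem <| .inl <| .inr rfl
  have mx (σ) : res σ W.xFun ∈ Algebra.adjoin F S :=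
    hmem <| .inr <| .inl <| ⟨σ, rfl⟩
  have my (σ) : res σ W.yFun ∈ Algebra.adjoin F S :=
    hmem <| .inr <| .inr <| .inl <| ⟨σ, rfl⟩
  have mdf (σ) : (res σ (am df))⁻¹ ∈ Algebra.adjoin F S :=
    hmem <| .inr <| .inr <| .inr <| .inl <| ⟨σ, rfl⟩
  have mdg (σ) : (res σ (am dg))⁻¹ ∈ Algebra.adjoin F S :=
    hmem <| .inr <| .inr <| .inr <| .inr <| .inl <| ⟨σ, rfl⟩
  have mr (σ) : (res σ (aeval W.xFun r))⁻¹ ∈ Algebra.adjoin F S :=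
    hmem <| .inr <| .inr <| .inr <| .inr <| .inr <| .inl <| ⟨σ, rfl⟩
  have mxx (σ τ) : (res σ W.xFun - res τ W.xFun)⁻¹ ∈ Algebra.adjoin F S :=
    hmem <| .inr <| .inr <| .inr <| .inr <| .inr <| .inr <| .inl <| ⟨(σ, τ), rfl⟩
  have myy (σ τ) : (res σ W.yFun - res τ W.yFun)⁻¹ ∈ Algebra.adjoin F S :=
    hmem <| .inr <| .inr <| .inr <| .inr <| .inr <| .inr <| .inr <| ⟨(σ, τ), rfl⟩
  have hresf (σ) : res σ f = algebraMap _ Ω f :=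
    σ.commutes ⟨f, IntermediateField.subset_adjoin _ _ (by simp)⟩
  have hresg (σ) : res σ g = algebraMap _ Ω g :=
    σ.commutes ⟨g, IntermediateField.subset_adjoin _ _ (by simp)⟩
  let P (σ : W.toAffine.FunctionField →ₐ[L] Ω) : W.GeomPoint :=
    .some (ρ ⟨_, mx σ⟩) (ρ ⟨_, my σ⟩)
      (Affine.equation_iff_nonsingular.1 (equation_specialization (res σ) ρ (mx σ) (my σ)))
  have hP (σ) : φ (P σ) ≠ 0 := by
    intro h0
    have h1 : aeval (ρ ⟨_, mx σ⟩) r = 0 := hr _ h0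
    rw [aeval_algHom_apply] at h1
    refine ρ.ne_zero_of_inv_mem ?_ ?_ h1
    · rw [← Subalgebra.coe_val, ← aeval_algHom_apply]
      change aeval (res σ W.xFun) r ≠ 0
      rw [aeval_algHom_apply]
      exact (map_ne_zero_iff _ (res σ).injective).2 (aeval_xFun_ne_zero hr0)
    · rw [← Subalgebra.coe_val, ← aeval_algHom_apply]
      change (aeval (res σ W.xFun) r)⁻¹ ∈ _
      rw [aeval_algHom_apply]
      exact mr σ
  have hval (σ) : xCoord (φ (P σ)) = ρ ⟨_, mf⟩ ∧ yCoord (φ (P σ)) = ρ ⟨_, mg⟩ := by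
    obtain ⟨h1, h2⟩ := h.hasValueAt (hP σ)
    have he := equation_specialization (res σ) ρ (mx σ) (my σ)
    have h3 := hasValueAt_specialization (res σ) ρ (mx σ) (my σ) (u := f)
      (by rw [hresf]; exact mf) hdf hf (mdf σ)
    have h4 := hasValueAt_specialization (res σ) ρ (mx σ) (my σ) (u := g)
      (by rw [hresg]; exact mg) hdg hg (mdg σ)
    refine ⟨(HasValueAt.unique he h1 h3).trans ?_, (HasValueAt.unique he h2 h4).trans ?_⟩
    · congr 2; exact hresf σ
    · congr 2; exact hresg σ
  have hPinj : Function.Injective P := by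
    intro σ τ hst
    by_contra hne
    obtain ⟨h1, h2⟩ := (Affine.Point.some.injEq ..).mp hst
    have hne' : res σ W.xFun - res τ W.xFun ≠ 0 ∨ res σ W.yFun - res τ W.yFun ≠ 0 := by
      by_contra! hc
      refine hne (AlgHom.ext fun z => ?_)
      exact congrArg (fun θ : W.toAffine.FunctionField →ₐ[F] Ω => θ z)
        (functionField_algHom_ext (σ := res σ) (τ := res τ) (sub_eq_zero.1 hc.1) (sub_eq_zero.1 hc.2))
    rcases hne' with h0 | h0
    · exact ρ.ne_zero_of_inv_mem (z := ⟨_, mx σ⟩ - ⟨_, mx τ⟩) h0 (mxx σ τ)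
        (by rw [map_sub, h1, sub_self])
    · exact ρ.ne_zero_of_inv_mem (z := ⟨_, my σ⟩ - ⟨_, my τ⟩) h0 (myy σ τ)
        (by rw [map_sub, h2, sub_self])
  have hφ (σ τ) : φ (P σ) = φ (P τ) := eq_of_coords (hP σ) (hP τ)
    ((hval σ).1.trans (hval τ).1.symm) ((hval σ).2.trans (hval τ).2.symm)
  rw [← hcard, ← Nat.card_eq_fintype_card]
  obtain ⟨σ₀⟩ : Nonempty (W.toAffine.FunctionField →ₐ[L] Ω) :=
    Fintype.card_pos_iff.1 (hcard ▸ Nat.pos_of_ne_zero hd)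
  have : Finite φ.ker := hfin
  refine Nat.card_le_card_of_injective
    (fun σ => (⟨P σ - P σ₀, by rw [AddMonoidHom.mem_ker, map_sub, hφ σ σ₀, sub_self]⟩ : φ.ker)) ?_
  intro σ τ hst
  exact hPinj (sub_left_injective (congrArg Subtype.val hst))

end WeierstrassCurve

/-! ### Conjugates of the abscissa of a torsion point -/

/-- The degree of an algebraic element is at most the number of its conjugates. -/
lemma natDegree_minpoly_le_ncard {F : Type*} [Field F] [CharZero F] {x : AlgebraicClosure F}
    {s : Set (AlgebraicClosure F)} (hs : s.Finite)
    (h : ∀ σ : AlgebraicClosure F →ₐ[F] AlgebraicClosure F, σ x ∈ s) :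
    (minpoly F x).natDegree ≤ s.ncard := by
  classical
  have hx : IsIntegral F x := Algebra.IsIntegral.isIntegral x
  rw [← card_rootSet_eq_natDegree (K := AlgebraicClosure F) (minpoly.irreducible hx).separable
    (IsAlgClosed.splits _), ← Nat.card_eq_fintype_card, Nat.card_coe_set_eq]
  refine Set.ncard_le_ncard (fun y hy => ?_) hs
  obtain ⟨σ, hσ⟩ := minpoly.exists_algEquiv_of_root' (K := F) hx.isAlgebraic
    (mem_rootSet.1 hy).2
  exact hσ ▸ h σ

namespace WeierstrassCurve
open Affine.Point hiding map_zero
open IsLocalRing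

lemma isUnit_Δ_integralModel {R K : Type*} [CommRing R] [IsDomain R] [IsDiscreteValuationRing R]
    [Field K] [Algebra R K] [IsFractionRing R K] {W : WeierstrassCurve K} [IsMinimal R W]
    (h : HasGoodReduction R W) : IsUnit (W.integralModel R).Δ := by
  have h1 := ((hasGoodReduction_iff_isElliptic_reduction R).1 h).isUnit
  rw [reduction, map_Δ] at h1
  exact (isUnit_map_iff (residue R) _).1 h1

/-- Over an absolutely unramified base, the abscissa of a point of order `p` on a curve with good
supersingular reduction has at least `p` conjugates. -/
theorem le_ncard_of_hasGoodSupersingularReduction {p : ℕ} (hp : p.Prime) {R K : Type*} [CommRing R]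
    [IsDomain R] [IsDiscreteValuationRing R] [CharZero R] [Field K] [Algebra R K]
    [IsFractionRing R K] (hpm : (p : R) ∈ maximalIdeal R) (hpm2 : (p : R) ∉ maximalIdeal R ^ 2)
    {W : WeierstrassCurve K} (hW : W.HasGoodSupersingularReduction p R) {P : W.GeomPoint}
    (hP : P ≠ 0) (hpP : p • P = 0) {s : Set (AlgebraicClosure K)} (hs : s.Finite)
    (h : ∀ σ : AlgebraicClosure K →ₐ[K] AlgebraicClosure K, σ (xCoord P) ∈ s) : p ≤ s.ncard := by
  classical
  have : CharZero K := charZero_of_injective_algebraMap (IsFractionRing.injective R K)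
  obtain ⟨C, hmin, hgood, hss⟩ := hW
  set ι := algebraMap K (AlgebraicClosure K)
  set M := (C • W).integralModel R
  have hM : M.map (algebraMap R K) = C • W := baseChange_integralModel_eq R (C • W)
  have hΔ : IsUnit M.Δ := isUnit_Δ_integralModel hgood
  have hC : C.map ι • W.map ι = (C • W).map ι := map_variableChange ..
  set u := (C.map ι).u
  set r := (C.map ι).r
  -- The abscissa on the minimal model. The change of variables is defined over `K`, so the
  -- conjugates correspond.
  set x := ((u : AlgebraicClosure K) ^ 2)⁻¹ * (xCoord P - r) with hx
  have hxP : (u : AlgebraicClosure K) ^ 2 * x + r = xCoord P := by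
    rw [hx, mul_inv_cancel_left₀ (pow_ne_zero 2 u.ne_zero), sub_add_cancel]
  have hdeg : (minpoly K x).natDegree ≤ s.ncard := by
    refine (natDegree_minpoly_le_ncard
      (hs.image fun z => ((u : AlgebraicClosure K) ^ 2)⁻¹ * (z - r)) fun σ => ?_).trans
      (Set.ncard_image_le hs)
    refine ⟨_, h σ, ?_⟩
    have hu : σ (u : AlgebraicClosure K) = u := σ.commutes (C.u : K)
    have hr : σ r = r := σ.commutes C.r
    simp only [hx, map_mul, map_inv₀, map_pow, map_sub, hu, hr]
  by_contra! hlt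
  rcases eq_or_ne p 2 with rfl | hp2
  -- For `p = 2`, fewer than two conjugates means that `x` lies in `K`.
  · have h1 : (minpoly K x).natDegree = 1 :=
      le_antisymm (by omega) (minpoly.natDegree_pos (Algebra.IsIntegral.isIntegral x))
    obtain ⟨z, hz⟩ := minpoly.natDegree_eq_one_iff.1 h1
    have h0 : (W.map ι).Ψ₂Sq.eval (xCoord P) = 0 := by
      have := etaCoord_sq hP
      rw [(etaCoord_eq_zero_iff hP).2 (by rwa [two_nsmul] at hpP)] at this
      rw [← this, sq, mul_zero]
    rw [← hxP, Ψ₂Sq_variableChange, hC, mul_eq_zero,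
      or_iff_right (pow_ne_zero 6 (Units.ne_zero _)), map_Ψ₂Sq, ← hz, eval_map, eval₂_at_apply,
      map_eq_zero, ← hM] at h0
    exact Ψ₂Sq_eval_ne_zero_of_isSupersingular hΔ (by exact_mod_cast hpm) (by exact_mod_cast hpm2)
      hss z h0
  · have h0 := preΨ'_eval_xCoord_eq_zero hp hp2 hP hpP
    rw [← hxP] at h0
    have h1 := preΨ'_variableChange_eq_zero _ _ _ h0
    rw [hC, ← hM, map_map, map_preΨ', eval_map] at h1
    have hpR : (p : R) ≠ 0 := Nat.cast_ne_zero.2 hp.ne_zero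
    have hodd : ¬ Even p := fun he => hp2 (hp.even_iff.1 he)
    obtain ⟨c0, ci⟩ := preΨ'_coeff_of_isSupersingular hΔ hp hp2 hss
    have hp3 : 3 ≤ p := by have := hp.two_le; omega
    have key := natDegree_minpoly_of_reverse_eisenstein (K := K) (L := AlgebraicClosure K) c0 ci
      (by rwa [leadingCoeff_preΨ' _ hpR, if_neg hodd])
      (natDegree_preΨ'_pos _ (by omega) hpR) (x := x) h1
    rw [natDegree_preΨ' _ hpR, if_neg hodd] at key
    -- This makes the degree `(p ^ 2 - 1) / 2` at least `p`; it uses `p ≥ 3`.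
    have : p * 2 ≤ p ^ 2 - 1 := by
      have : p * 3 ≤ p ^ 2 := by nlinarith
      omega
    omega

end WeierstrassCurve

/-! ### Ramification index and the valuation of `p` -/

section Ramification

variable (p : ℕ) [Fact p.Prime] (F : Type*) [Field F] [Algebra ℚ_[p] F] [Algebra ℤ_[p] F]

open IsLocalRing

lemma charZero_padicRingOfIntegers : CharZero (PadicRingOfIntegers p F) := by
  have : CharZero F := charZero_of_injective_algebraMap (algebraMap ℚ_[p] F).injective
  infer_instance

variable [FiniteDimensional ℚ_[p] F] [IsScalarTower ℤ_[p] ℚ_[p] F]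

lemma natCast_mem_maximalIdeal_padicRingOfIntegers :
    (p : PadicRingOfIntegers p F) ∈ maximalIdeal (PadicRingOfIntegers p F) := by
  rw [mem_maximalIdeal, mem_nonunits_iff, isUnit_padicRingOfIntegers_iff]
  have he : ((p : PadicRingOfIntegers p F) : F) = algebraMap ℚ_[p] F (p : ℚ_[p]) := by simp
  rw [he, spectralNorm_extends]
  exact (Padic.norm_p_lt_one (p := p)).ne

/-- If `p` lies in the square of the maximal ideal, the extension is ramified. -/
theorem one_lt_ramificationIdx_of_natCast_mem_sq
    (h : (p : PadicRingOfIntegers p F) ∈ maximalIdeal (PadicRingOfIntegers p F) ^ 2) :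
    1 < (maximalIdeal (PadicRingOfIntegers p F)).ramificationIdx ℤ_[p] := by
  have := charZero_padicRingOfIntegers p F
  set O := PadicRingOfIntegers p F
  have hmap : (maximalIdeal ℤ_[p]).map (algebraMap ℤ_[p] O) = Ideal.span {(p : O)} := by
    rw [PadicInt.maximalIdeal_eq_span_p, Ideal.map_span, Set.image_singleton, map_natCast]
  have hp0 : (p : O) ≠ 0 := Nat.cast_ne_zero.2 (Fact.out : p.Prime).ne_zero
  have hne : (maximalIdeal ℤ_[p]).map (algebraMap ℤ_[p] O) ≠ ⊥ := by
    rw [hmap, Ne, Ideal.span_singleton_eq_bot]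
    exact hp0
  have hle : (maximalIdeal ℤ_[p]).map (algebraMap ℤ_[p] O) ≤ maximalIdeal O := by
    rw [hmap, Ideal.span_singleton_le_iff_mem]
    exact natCast_mem_maximalIdeal_padicRingOfIntegers p F
  have : (maximalIdeal O).LiesOver (maximalIdeal ℤ_[p]) := ⟨by
    have := Ideal.map_le_iff_le_comap.1 hle
    exact (maximalIdeal.isMaximal ℤ_[p]).eq_of_le (Ideal.comap_ne_top _ (maximalIdeal.isMaximal O).ne_top) this⟩
  rw [Ideal.IsDedekindDomain.ramificationIdx_eq_multiplicity (maximalIdeal ℤ_[p]) _ hne, hmap]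
  have hfin : FiniteMultiplicity (maximalIdeal O) (Ideal.span {(p : O)}) := by
    refine FiniteMultiplicity.of_prime_left ?_ ?_
    · refine Ideal.prime_of_isPrime (ne_bot_of_le_ne_bot hne hle) inferInstance
    · rw [← hmap]; exact hne
  exact hfin.le_multiplicity_of_pow_dvd (Ideal.dvd_iff_le.2 ((Ideal.span_singleton_le_iff_mem _).2 h))

end Ramification

end

/-! ### Conclusion -/

theorem mainTheorem3 (p : ℕ) [Fact p.Prime] (F : Type*) [Field F]
    [Algebra ℚ_[p] F] [FiniteDimensional ℚ_[p] F]
    [Algebra ℤ_[p] F] [IsScalarTower ℤ_[p] ℚ_[p] F]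
    (E E' : WeierstrassCurve F) [E.IsElliptic] [E'.IsElliptic]
    (φ : E.GeomPoint →+ E'.GeomPoint) (hφ : WeierstrassCurve.IsIsogenyOfDegree φ p)
    (hE : E.HasGoodSupersingularReduction p (PadicRingOfIntegers p F)) :
    1 < (IsLocalRing.maximalIdeal (PadicRingOfIntegers p F)).ramificationIdx ℤ_[p] := by
  have hp : p.Prime := Fact.out
  have : CharZero F := charZero_of_injective_algebraMap (algebraMap ℚ_[p] F).injective
  have := charZero_padicRingOfIntegers p F
  refine one_lt_ramificationIdx_of_natCast_mem_sq p F ?_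
  by_contra hsq
  obtain ⟨hfin, f, g, hfg, hdeg⟩ := hφ
  have hcard : Nat.card φ.ker = p := by
    rw [← hdeg]
    exact (WeierstrassCurve.card_ker_le hfin hfg (hdeg ▸ hp.ne_zero)).antisymm
      (WeierstrassCurve.ratMapDegree_le_card_ker hfin hfg (hdeg ▸ hp.ne_zero))
  have : Finite φ.ker := hfin
  have : Nontrivial φ.ker := Finite.one_lt_card_iff_nontrivial.1 (hcard ▸ hp.one_lt)
  obtain ⟨P, hP⟩ := exists_ne (0 : φ.ker)
  have hpP : p • (P : E.GeomPoint) = 0 := by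
    have : p • P = 0 := by rw [← hcard]; exact card_nsmul_eq_zero'
    simpa using congrArg Subtype.val this
  -- Removing the origin matters: it leaves `p - 1` points, so fewer than `p` possible conjugates.
  have hfin' : ((φ.ker : Set E.GeomPoint) \ {0}).Finite := hfin.subset Set.sdiff_subset
  have key := WeierstrassCurve.le_ncard_of_hasGoodSupersingularReduction hp
    (natCast_mem_maximalIdeal_padicRingOfIntegers p F) hsq hE (P := P)
    (fun h => hP (Subtype.ext h)) hpP (hfin'.image WeierstrassCurve.Affine.Point.xCoord) fun σ => by
      rw [← WeierstrassCurve.xCoord_galoisMap]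
      refine ⟨_, ⟨WeierstrassCurve.galoisMap_mem_ker hfin hfg σ P.2, fun h => hP ?_⟩, rfl⟩
      exact Subtype.ext (WeierstrassCurve.galoisMap_injective σ (h.trans (map_zero _).symm))
  have h2 := key.trans (Set.ncard_image_le hfin')
  rw [Set.ncard_sdiff_singleton_of_mem (zero_mem φ.ker), ← Nat.card_coe_set_eq] at h2
  have h3 : Nat.card (φ.ker : Set E.GeomPoint) = p := hcard
  have := hp.pos
  omega
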